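/- Let $d\ge 2$ be an integer, let $K$ be a number field of degree $k=[K:\mathbb Q]$ with ring of integers $\mathfrak o$, and let $\mathcal P_K$ be the set of non-zero prime ideals of $\mathfrak o$. For $\mathfrak p\in\mathcal P_K$ let $N(\mathfrak p)=|\mathfrak o/\mathfrak p|$, let $p_{\mathfrak p}$ be the rational prime below $\mathfrak p$, and let $\mathfrak o_{\mathfrak p}$ be the ring of integers of the completion $K_{\mathfrak p}$, with normalised Haar measure. For an integral basis $\mathbb E=(e_1,\dots,e_k)$ of $\mathfrak o$ and an integer $H\ge 0$ put $O(H,\mathbb E)=\{\sum_j a_je_j : a_j\in[-H,H)\cap\mathbb Z\}$. The density $\rho_{\mathbb E}(T)$ (upper density $\overline\rho_{\mathbb E}(T)$) of $T\subseteq\mathfrak o^{d+1}$ is the limit (limsup) of $|T\cap O(H,\mathbb E)^{d+1}|/(2H)^{k(d+1)}$ as $H\to\infty$. A tuple $(a_0,\dots,a_d)\in\mathfrak o^{d+1}$, regarded as the polynomial $\sum_i a_ix^i$, is $\mathfrak p$-Eisenstein if $a_d\notin\mathfrak p$, $a_0\notin\mathfrak p^2$ and $a_i\in\mathfrak p$ for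 $0\le i\le d-1$. Let $\Gamma^d$ be the set of tuples that are $\mathfrak p$-Eisenstein for some $\mathfrak p\in\mathcal P_K$. Put $$U_{\mathfrak p}=(\mathfrak p\mathfrak o_{\mathfrak p}\setminus\mathfrak p^2\mathfrak o_{\mathfrak p})\times(\mathfrak p\mathfrak o_{\mathfrak p})^{d-1}\times(\mathfrak o_{\mathfrak p}\setminus\mathfrak p\mathfrak o_{\mathfrak p})\subseteq\mathfrak o_{\mathfrak p}^{d+1},\qquad U_\infty=\emptyset\subseteq(\mathfrak o\otimes_{\mathbb Z}\mathbb R)^{d+1}.$$ For $A\in\mathfrak o^{d+1}$ let $P(A)=\{\eta\in\mathcal P_K\cup\{\infty\}: A\in U_\eta\}$, let $I$ be the set of $A$ with $P(A)$ infinite, and let $B_H=O(H,\mathbb E)^{d+1}\setminus I$. Then the following hold for every integral basis $\mathbb E$ of $\mathfrak o$. 1. The system $(U_\eta)$ corresponds to $\Gamma^d$: the complement of $\Gamma^d$ is $\{A : P(A)=\emptyset\}$, and condition (c) below holds. 2. For every integer $n\ge1$ the system satisfies the following hypotheses of the local-to-global principle for $n$-th moments. (a) The boundary of each $U_{\mathfrak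 p}$ has Haar measure $0$. (b) The boundary of $U_\infty$ has Lebesgue measure $0$, and $\mathbb R_{\ge0}\cdot U_\infty=U_\infty$. (c) $\lim_{M\to\infty}\overline\rho_{\mathbb E}\left(\{A\in\mathfrak o^{d+1} : A\in U_{\mathfrak p}\text{ for some }\mathfrak p\text{ with }p_{\mathfrak p}>M\}\right)=0$. (d) There are a real $\alpha\ge0$, integers $c',c$ and a family of reals $(v_{\mathfrak p})_{\mathfrak p\in\mathcal P_K}$ with $\sum_{\mathfrak p}v_{\mathfrak p}$ convergent such that, for all integers $H\ge1$: every $A\in B_H$ satisfies $|\{\mathfrak p : p_{\mathfrak p}>c'H^\alpha,\ A\in U_{\mathfrak p}\}|<c$; and every set $\{\mathfrak p_1,\dots,\mathfrak p_m\}$ of $m$ distinct primes with $1\le m\le n$ and all $p_{\mathfrak p_j}\le c'H^\alpha$ satisfies $$\Big|B_H\cap\bigcap_{j=1}^mU_{\mathfrak p_j}\Big|\le(2H)^{k(d+1)}\prod_{j=1}^mv_{\mathfrak p_j}.$$ 3. Put $s_{\mathfrak p}=\dfrac{(N(\mathfrak p)-1)^2}{N(\mathfrak p)^{d+2}}$.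 The product $\prod_{\mathfrak p}(1-s_{\mathfrak p})$ and the sums $\sum_{\mathfrak p} s_{\mathfrak p}$, $\sum_{\mathfrak p} s_{\mathfrak p}^2$ converge, and the density of $\Gamma^d$, the expected value $\mu$ of the system and its expected value $\mu_{\Gamma^d}$ restricted to $\Gamma^d$ exist, do not depend on $\mathbb E$, and are $$\rho(\Gamma^d)=1-\prod_{\mathfrak p\in\mathcal P_K}(1-s_{\mathfrak p})>0,$$ $$\mu=\lim_{H\to\infty}\frac{\sum_{A\in B_H}|P(A)|}{(2H)^{k(d+1)}}=\sum_{\mathfrak p\in\mathcal P_K}s_{\mathfrak p},$$ $$\mu_{\Gamma^d}=\lim_{H\to\infty}\frac{\sum_{A\in B_H\cap\Gamma^d}|P(A)|}{|B_H\cap\Gamma^d|}=\rho(\Gamma^d)^{-1}\mu .$$ 4. The variance restricted to $\Gamma^d$ exists, does not depend on $\mathbb E$, and is $$\sigma^2_{\Gamma^d}=\lim_{H\to\infty}\frac{\sum_{A\in B_H\cap\Gamma^d}(|P(A)|-\mu_{\Gamma^d})^2}{|O(H,\mathbb E)^{d+1}\cap\Gamma^d|}=\frac1{\rho(\Gamma^d)}\Big(\mu^2-\sum_{\mathfrak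 p\in\mathcal P_K}s_{\mathfrak p}^2+\mu\Big)-\frac{2\mu_{\Gamma^d}}{\rho(\Gamma^d)}\mu+\mu_{\Gamma^d}^2 .$$ -/

import Mathlib

open NumberField IsDedekindDomain

namespace EisensteinMoments

/-! ## Completions at the non-zero primes and their Haar measures

The set of non-zero primes of `𝓞 K` is `HeightOneSpectrum (𝓞 K)`; the completion of `𝓞 K` at `𝔭`
is `𝔭.adicCompletionIntegers K`. -/

section Local

open HeightOneSpectrum
open scoped Valued WithZero

instance instCompactSpaceAdicIntegers (K : Type*) [Field K] [NumberField K]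
    (𝔭 : HeightOneSpectrum (𝓞 K)) : CompactSpace (𝔭.adicCompletionIntegers K) := by
  have hDVR : IsDiscreteValuationRing 𝒪[𝔭.adicCompletion K] :=
    inferInstanceAs (IsDiscreteValuationRing (𝔭.adicCompletionIntegers K))
  have hcomp : CompleteSpace 𝒪[𝔭.adicCompletion K] :=
    (Valued.isClosed_integer (𝔭.adicCompletion K)).completeSpace_coe
  have hfin : Finite 𝓀[𝔭.adicCompletion K] := by
    have : Finite (𝓞 K ⧸ 𝔭.asIdeal) := 𝔭.asIdeal.finiteQuotientOfFreeOfNeBot 𝔭.ne_bot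
    let g : 𝓞 K →+* 𝓀[𝔭.adicCompletion K] :=
      (IsLocalRing.residue 𝒪[𝔭.adicCompletion K]).comp
        (algebraMap (𝓞 K) (𝔭.adicCompletionIntegers K))
    have key : ∀ x : 𝒪[𝔭.adicCompletion K], Valued.v (x : 𝔭.adicCompletion K) < 1 →
        IsLocalRing.residue 𝒪[𝔭.adicCompletion K] x = 0 := by
      intro x hx
      rw [IsLocalRing.residue_eq_zero_iff]
      exact (Valuation.Integer.not_isUnit_iff_valuation_lt_one).2 hx
    have hg : ∀ r ∈ 𝔭.asIdeal, g r = 0 := by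
      intro r hr
      apply key
      change Valued.v ((algebraMap (𝓞 K) K r : K) : 𝔭.adicCompletion K) < 1
      rw [valuedAdicCompletion_eq_valuation']
      exact (valuation_lt_one_iff_mem 𝔭 r).2 hr
    have hsurj : Function.Surjective g := by
      intro y
      obtain ⟨x, rfl⟩ := IsLocalRing.residue_surjective y
      obtain ⟨k, hk⟩ : ∃ k : K, Valued.v ((x : 𝔭.adicCompletion K) - (k : 𝔭.adicCompletion K)) < 1 := by
        have hopen : IsOpen {z : 𝔭.adicCompletion K | Valued.v ((x : 𝔭.adicCompletion K) - z) < 1} := by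
          have := (Valued.isOpen_ball (𝔭.adicCompletion K) 1).preimage
            (continuous_const.sub continuous_id : Continuous fun z => (x : 𝔭.adicCompletion K) - z)
          simpa [Set.preimage, Valuation.restrict_lt_one_iff] using this
        exact (denseRange_algebraMap K 𝔭).exists_mem_open hopen ⟨x, by simp⟩
      have hk1 : 𝔭.valuation K k ≤ 1 := by
        rw [← valuedAdicCompletion_eq_valuation']
        have : (k : 𝔭.adicCompletion K) = x - (x - k) := by ring
        rw [this]
        exact (Valuation.map_sub _ _ _).trans (max_le x.2 hk.le)
      obtain ⟨a, ha⟩ := exists_valuation_sub_lt_of_integer 𝔭 hk1 1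
      refine ⟨a, ?_⟩
      rw [← sub_eq_zero]
      change IsLocalRing.residue 𝒪[𝔭.adicCompletion K] _ - IsLocalRing.residue 𝒪[𝔭.adicCompletion K] _ = 0
      rw [← map_sub]
      apply key
      change Valued.v (((algebraMap (𝓞 K) K a : K) : 𝔭.adicCompletion K) - x) < 1
      have h1 : Valued.v (((algebraMap (𝓞 K) K a : K) : 𝔭.adicCompletion K) - (k : 𝔭.adicCompletion K)) < 1 := by
        rw [← valuedAdicCompletion_eq_valuation'] at ha
        have h2 : (((algebraMap (𝓞 K) K a - k : K)) : 𝔭.adicCompletion K) =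
            ((algebraMap (𝓞 K) K a : K) : 𝔭.adicCompletion K) - (k : 𝔭.adicCompletion K) :=
          map_sub (algebraMap K (𝔭.adicCompletion K)) _ _
        rw [← h2]
        simpa using ha
      have : ((algebraMap (𝓞 K) K a : K) : 𝔭.adicCompletion K) - x =
        (((algebraMap (𝓞 K) K a : K) : 𝔭.adicCompletion K) - (k : 𝔭.adicCompletion K)) - (x - k) := by ring
      rw [this]
      exact (Valuation.map_sub _ _ _).trans_lt (max_lt h1 hk)
    exact Finite.of_surjective (Ideal.Quotient.lift 𝔭.asIdeal g hg)
      (Ideal.Quotient.lift_surjective_of_surjective _ hg hsurj)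
  exact Valued.integer.compactSpace_iff_completeSpace_and_isDiscreteValuationRing_and_finite_residueField.2
    ⟨hcomp, hDVR, hfin⟩

noncomputable instance instMeasurableSpaceAdicIntegers (K : Type*) [Field K] [NumberField K]
    (𝔭 : HeightOneSpectrum (𝓞 K)) : MeasurableSpace (𝔭.adicCompletionIntegers K) :=
  borel _

instance instBorelSpaceAdicIntegers (K : Type*) [Field K] [NumberField K]
    (𝔭 : HeightOneSpectrum (𝓞 K)) : BorelSpace (𝔭.adicCompletionIntegers K) :=
  ⟨rfl⟩

/-- The Haar measure on the compact group `𝔬_𝔭`, normalised to have total mass one. -/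
noncomputable def haar (K : Type*) [Field K] [NumberField K] (𝔭 : HeightOneSpectrum (𝓞 K)) :
    MeasureTheory.Measure (𝔭.adicCompletionIntegers K) :=
  MeasureTheory.Measure.addHaarMeasure ⊤

/-- The normalised Haar measure on `𝔬_𝔭 ^ m`. -/
noncomputable def haarPow (K : Type*) [Field K] [NumberField K] (𝔭 : HeightOneSpectrum (𝓞 K))
    (m : ℕ) : MeasureTheory.Measure (Fin m → 𝔭.adicCompletionIntegers K) :=
  MeasureTheory.Measure.pi fun _ => haar K 𝔭

end Local

/-- The rational prime `p` below `𝔭`, that is, the positive generator of `𝔭 ∩ ℤ`. -/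
noncomputable def primeBelow {K : Type*} [Field K] [NumberField K]
    (𝔭 : HeightOneSpectrum (𝓞 K)) : ℕ :=
  Ideal.absNorm (𝔭.asIdeal.under ℤ)

/-! ## Boxes and densities in `𝓞 K ^ m` -/

section Density

variable {K : Type*} [Field K] [NumberField K] {ι : Type*} [Fintype ι]

open scoped Classical in
/-- `O(H, 𝔼)`: the elements `∑ j, a j • E j` with integers `a j ∈ [-H, H)`. -/
noncomputable def box₁ (E : Module.Basis ι ℤ (𝓞 K)) (H : ℕ) : Finset (𝓞 K) :=
  (Fintype.piFinset fun _ : ι => Finset.Ico (-(H : ℤ)) (H : ℤ)).map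
    E.equivFun.symm.toEquiv.toEmbedding

/-- `O(H, 𝔼) ^ m`. -/
noncomputable def box (E : Module.Basis ι ℤ (𝓞 K)) (m H : ℕ) : Finset (Fin m → 𝓞 K) :=
  Fintype.piFinset fun _ => box₁ E H

/-- `(2H) ^ (k m)` with `k = [K : ℚ]`, the number of points of `O(H, 𝔼) ^ m`. -/
noncomputable def boxSize (K : Type*) [Field K] [NumberField K] (m H : ℕ) : ℝ :=
  (2 * (H : ℝ)) ^ (Module.finrank ℚ K * m)

/-- The upper density of a subset of `𝓞 K ^ m` with respect to an integral basis. -/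
noncomputable def upperDensity (E : Module.Basis ι ℤ (𝓞 K)) {m : ℕ} (T : Set (Fin m → 𝓞 K)) : ℝ :=
  Filter.limsup (fun H : ℕ => (((box E m H : Set (Fin m → 𝓞 K)) ∩ T).ncard : ℝ) / boxSize K m H)
    Filter.atTop

/-- The density of `T` with respect to the integral basis `E` exists and equals `r`. -/
def HasDensity (E : Module.Basis ι ℤ (𝓞 K)) {m : ℕ} (T : Set (Fin m → 𝓞 K)) (r : ℝ) : Prop :=
  Filter.Tendsto
    (fun H : ℕ => (((box E m H : Set (Fin m → 𝓞 K)) ∩ T).ncard : ℝ) / boxSize K m H)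
    Filter.atTop (nhds r)

end Density

/-! ## Systems `(U_η)` indexed by the non-zero primes together with `∞` -/

/-- A system of sets `U_𝔭 ⊆ 𝔬_𝔭 ^ m` and `U_∞ ⊆ k_∞ ^ m`, where `k_∞ = 𝔬 ⊗ ℝ` is realised as the
mixed space `ℝ ^ r₁ × ℂ ^ r₂`. -/
structure LocalSystem (K : Type*) [Field K] [NumberField K] (m : ℕ) where
  /-- the sets at the non-zero primes -/
  fin : ∀ 𝔭 : HeightOneSpectrum (𝓞 K), Set (Fin m → 𝔭.adicCompletionIntegers K)
  /-- the set at infinity -/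
  inf : Set (Fin m → mixedEmbedding.mixedSpace K)

namespace LocalSystem

variable {K : Type*} [Field K] [NumberField K] {m : ℕ}

/-- `A ∈ U_η` for `A ∈ 𝓞 K ^ m`; here `none` stands for `η = ∞` and `some 𝔭` for `η = 𝔭`. -/
def Mem (U : LocalSystem K m) (A : Fin m → 𝓞 K) : Option (HeightOneSpectrum (𝓞 K)) → Prop
  | none => (fun i => mixedEmbedding K (A i : K)) ∈ U.inf
  | some 𝔭 => (fun i => algebraMap (𝓞 K) (𝔭.adicCompletionIntegers K) (A i)) ∈ U.fin 𝔭

/-- `P(A) = {η : A ∈ U_η}`. -/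
def places (U : LocalSystem K m) (A : Fin m → 𝓞 K) : Set (Option (HeightOneSpectrum (𝓞 K))) :=
  {η | U.Mem A η}

/-- The exceptional set `I` of those `A` that lie in infinitely many of the `U_η`. -/
def exceptional (U : LocalSystem K m) : Set (Fin m → 𝓞 K) :=
  {A | (U.places A).Infinite}

variable {ι : Type*} [Fintype ι]

open scoped Classical in
/-- `O(H, 𝔼) ^ m` without the exceptional set `I`. -/
noncomputable def goodBox (U : LocalSystem K m) (E : Module.Basis ι ℤ (𝓞 K)) (H : ℕ) :
    Finset (Fin m → 𝓞 K) :=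
  (box E m H).filter fun A => A ∉ U.exceptional

/-- The tail condition: the upper density of
`{A : A ∈ U_𝔭 for some 𝔭 above a rational prime p > M}` tends to zero as `M → ∞`. -/
def TailCondition (U : LocalSystem K m) (E : Module.Basis ι ℤ (𝓞 K)) : Prop :=
  Filter.Tendsto
    (fun M : ℕ => upperDensity E
      {A | ∃ 𝔭 : HeightOneSpectrum (𝓞 K), M < primeBelow 𝔭 ∧ U.Mem A (some 𝔭)})
    Filter.atTop (nhds 0)

/-- The system corresponds to `T`: the tail condition holds, and the complement of `T` consists of
the `A` that lie in no `U_η`. -/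
def CorrespondsTo (U : LocalSystem K m) (E : Module.Basis ι ℤ (𝓞 K)) (T : Set (Fin m → 𝓞 K)) :
    Prop :=
  U.TailCondition E ∧ Tᶜ = U.places ⁻¹' {∅}

open scoped Classical Pointwise in
/-- The hypotheses of the local to global principle for the `n`-th moment, with respect to the
integral basis `E`. In `bounds`, the set `S` runs through the sets of values of the tuples
`(𝔭₁, …, 𝔭ₙ)` of non-zero primes, so that a prime that is repeated counts once; the exponent `α` is
finite. -/
structure MomentHypotheses (U : LocalSystem K m) (E : Module.Basis ι ℤ (𝓞 K)) (n : ℕ) : Prop where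
  /-- The boundary of `U_𝔭` is a null set. -/
  boundary_fin : ∀ 𝔭 : HeightOneSpectrum (𝓞 K), haarPow K 𝔭 m (frontier (U.fin 𝔭)) = 0
  /-- The boundary of `U_∞` is a null set. -/
  boundary_inf : MeasureTheory.volume (frontier U.inf) = 0
  /-- `U_∞` is a cone: `ℝ_{≥ 0} · U_∞ = U_∞`. -/
  cone_inf : {r : ℝ | 0 ≤ r} • U.inf = U.inf
  tail : U.TailCondition E
  bounds : ∃ α : ℝ, 0 ≤ α ∧ ∃ c' c : ℤ,
    (∀ H : ℕ, 1 ≤ H → ∀ A ∈ U.goodBox E H,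
      ({𝔭 : HeightOneSpectrum (𝓞 K) |
        (c' : ℝ) * (H : ℝ) ^ α < (primeBelow 𝔭 : ℝ) ∧ U.Mem A (some 𝔭)}.ncard : ℤ) < c) ∧
    ∃ v : HeightOneSpectrum (𝓞 K) → ℝ, Summable v ∧
      ∀ H : ℕ, 1 ≤ H → ∀ S : Finset (HeightOneSpectrum (𝓞 K)), S.Nonempty → S.card ≤ n →
        (∀ 𝔭 ∈ S, (primeBelow 𝔭 : ℝ) ≤ (c' : ℝ) * (H : ℝ) ^ α) →
        ({A | A ∈ U.goodBox E H ∧ ∀ 𝔭 ∈ S, U.Mem A (some 𝔭)}.ncard : ℝ) ≤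
          boxSize K m H * ∏ 𝔭 ∈ S, v 𝔭

/-- The `n`-th moment of the system exists and equals `r`. -/
def HasMoment (U : LocalSystem K m) (E : Module.Basis ι ℤ (𝓞 K)) (n : ℕ) (r : ℝ) : Prop :=
  Filter.Tendsto
    (fun H : ℕ => (∑ A ∈ U.goodBox E H, ((U.places A).ncard : ℝ) ^ n) / boxSize K m H)
    Filter.atTop (nhds r)

open scoped Classical in
/-- The `n`-th moment of the system restricted to `T` exists and equals `r`. -/
def HasRestrictedMoment (U : LocalSystem K m) (E : Module.Basis ι ℤ (𝓞 K))
    (T : Set (Fin m → 𝓞 K)) (n : ℕ) (r : ℝ) : Prop :=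
  Filter.Tendsto
    (fun H : ℕ => (∑ A ∈ U.goodBox E H with A ∈ T, ((U.places A).ncard : ℝ) ^ n) /
      (((U.goodBox E H).filter (· ∈ T)).card : ℝ))
    Filter.atTop (nhds r)

open scoped Classical in
/-- The variance of the system restricted to `T` exists and equals `r`: the mean `e` restricted to
`T` exists, and the mean over `T` of the squared deviation from `e` is `r`. -/
def HasRestrictedVariance (U : LocalSystem K m) (E : Module.Basis ι ℤ (𝓞 K))
    (T : Set (Fin m → 𝓞 K)) (r : ℝ) : Prop :=
  ∃ e : ℝ, U.HasRestrictedMoment E T 1 e ∧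
    Filter.Tendsto
      (fun H : ℕ => (∑ A ∈ U.goodBox E H with A ∈ T, (((U.places A).ncard : ℝ) - e) ^ 2) /
        (((box E m H).filter (· ∈ T)).card : ℝ))
      Filter.atTop (nhds r)

end LocalSystem

/-! ## Eisenstein polynomials -/

section Eisenstein

variable (K : Type*) [Field K] [NumberField K] (d : ℕ)

/-- The polynomial with coefficients `(a 0, …, a d)` is `𝔭`-Eisenstein (of degree `d`). -/
def IsEisensteinAt {K : Type*} [Field K] [NumberField K] {d : ℕ} (𝔭 : HeightOneSpectrum (𝓞 K))
    (a : Fin (d + 1) → 𝓞 K) : Prop :=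
  a (Fin.last d) ∉ 𝔭.asIdeal ∧ a 0 ∉ 𝔭.asIdeal ^ 2 ∧ ∀ i, i ≠ Fin.last d → a i ∈ 𝔭.asIdeal

/-- `Γ^d`: the Eisenstein polynomials of degree `d`, as tuples of coefficients. -/
def eisensteinSet : Set (Fin (d + 1) → 𝓞 K) :=
  {a | ∃ 𝔭 : HeightOneSpectrum (𝓞 K), IsEisensteinAt 𝔭 a}

/-- The ideal `𝔭^j 𝔬_𝔭` of `𝔬_𝔭`. -/
noncomputable def localIdeal {K : Type*} [Field K] [NumberField K] (𝔭 : HeightOneSpectrum (𝓞 K))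
    (j : ℕ) : Ideal (𝔭.adicCompletionIntegers K) :=
  (𝔭.asIdeal ^ j).map (algebraMap (𝓞 K) (𝔭.adicCompletionIntegers K))

/-- `U_𝔭 = (𝔭𝔬_𝔭 ∖ 𝔭²𝔬_𝔭) × (𝔭𝔬_𝔭)^(d-1) × (𝔬_𝔭 ∖ 𝔭𝔬_𝔭)` and `U_∞ = ∅` (for `d ≥ 1`). -/
def eisensteinSystem : LocalSystem K (d + 1) where
  fin 𝔭 := {a | (a 0 ∈ localIdeal 𝔭 1 ∧ a 0 ∉ localIdeal 𝔭 2) ∧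
    (∀ i, i ≠ 0 → i ≠ Fin.last d → a i ∈ localIdeal 𝔭 1) ∧ a (Fin.last d) ∉ localIdeal 𝔭 1}
  inf := ∅

/-- `(N(𝔭) - 1)² / N(𝔭)^(d+2)`, where `N(𝔭)` is the cardinality of `𝓞 K ⧸ 𝔭`. -/
noncomputable def eisensteinWeight {K : Type*} [Field K] [NumberField K] (d : ℕ)
    (𝔭 : HeightOneSpectrum (𝓞 K)) : ℝ :=
  ((Ideal.absNorm 𝔭.asIdeal : ℝ) - 1) ^ 2 / (Ideal.absNorm 𝔭.asIdeal : ℝ) ^ (d + 2)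

end Eisenstein

end EisensteinMoments

set_option linter.unusedSectionVars false

/-! For a fixed finite set `S` of primes, being Eisenstein at all of `S` is a condition on each
coefficient modulo `𝔭 ^ 2`, so the Chinese remainder theorem and equidistribution of boxes in
residue classes give it the density `∏ 𝔭 ∈ S, eisensteinWeight d 𝔭`. All the content lies in passing
from finitely many primes to all of them.

Write the number of Eisenstein primes of a tuple as a truncated count, over primes with residue
characteristic at most `H ^ (1 / n)`, plus a remainder `largeCount n H`. Up to `n` truncated primes
have residue characteristics with product at most `H`, so the frequency of any joint condition on
them is bounded uniformly by the summable weights `majorant` (`card_box_eisenstein_le`). Dominated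
convergence then yields the first and second moments of the truncated count.

The remainder is controlled by norms. A nonzero constant coefficient in the box has norm `O(H ^ k)`,
hence lies in boundedly many large primes (`exists_card_large_primes_lt`). For `n = 1` its mean
tends to zero: once the constant coefficient has left boundedly many primes above `H`, the linear
coefficient must lie in one of them, which has probability `O(1 / H)`
(`exists_sum_card_large_primes_le`). This gives the mean of the full count, and subtracting the
truncated mean shows that the remainder has mean tending to zero for every `n`. As it is bounded,
its second moment vanishes too, and Cauchy-Schwarz removes the cross term
(`tendsto_boxAverage_count_sq`).

The density and the tail condition follow from the mean: the Eisenstein primes outside a finite set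
`S` occur with mean `∑' 𝔭, eisensteinWeight d 𝔭 - ∑ 𝔭 ∈ S, eisensteinWeight d 𝔭`, which is small for
large `S`. The restricted mean and variance are quotients of these limits, since tuples outside
`Γ^d` have count zero. -/

namespace EisensteinMoments

/-! ### Primes of `𝓞 K`, their norms and the rational primes below them -/

section Primes

variable {K : Type*} [Field K] [NumberField K]

instance (𝔭 : HeightOneSpectrum (𝓞 K)) : NeZero 𝔭.asIdeal := ⟨𝔭.ne_bot⟩

theorem primeBelow_prime (𝔭 : HeightOneSpectrum (𝓞 K)) : (primeBelow 𝔭).Prime :=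
  Nat.absNorm_under_prime 𝔭.asIdeal

theorem primeBelow_mem (𝔭 : HeightOneSpectrum (𝓞 K)) : (primeBelow 𝔭 : 𝓞 K) ∈ 𝔭.asIdeal :=
  Int.absNorm_under_mem 𝔭.asIdeal

theorem absNorm_pos (𝔭 : HeightOneSpectrum (𝓞 K)) : 0 < Ideal.absNorm 𝔭.asIdeal :=
  Nat.pos_of_ne_zero (by rw [Ne, Ideal.absNorm_eq_zero_iff]; exact 𝔭.ne_bot)

theorem primeBelow_le_absNorm (𝔭 : HeightOneSpectrum (𝓞 K)) :
    primeBelow 𝔭 ≤ Ideal.absNorm 𝔭.asIdeal :=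
  Nat.le_of_dvd (absNorm_pos 𝔭) (Int.absNorm_under_dvd_absNorm 𝔭.asIdeal)

theorem two_le_absNorm (𝔭 : HeightOneSpectrum (𝓞 K)) : 2 ≤ Ideal.absNorm 𝔭.asIdeal :=
  (primeBelow_prime 𝔭).two_le.trans (primeBelow_le_absNorm 𝔭)

theorem natCast_mem_iff_primeBelow_dvd (𝔭 : HeightOneSpectrum (𝓞 K)) (n : ℕ) :
    (n : 𝓞 K) ∈ 𝔭.asIdeal ↔ primeBelow 𝔭 ∣ n := by
  constructor
  · intro h
    by_contra hn
    have hc : IsCoprime (primeBelow 𝔭 : ℤ) (n : ℤ) :=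
      Nat.isCoprime_iff_coprime.2 ((primeBelow_prime 𝔭).coprime_iff_not_dvd.2 hn)
    obtain ⟨a, b, hab⟩ := hc
    apply 𝔭.isPrime.ne_top
    rw [Ideal.eq_top_iff_one]
    have : (1 : 𝓞 K) = a * (primeBelow 𝔭 : 𝓞 K) + b * (n : 𝓞 K) := by
      exact_mod_cast congrArg (Int.cast : ℤ → 𝓞 K) hab.symm
    rw [this]
    exact add_mem (Ideal.mul_mem_left _ _ (primeBelow_mem 𝔭)) (Ideal.mul_mem_left _ _ h)
  · rintro ⟨c, rfl⟩
    rw [Nat.cast_mul]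
    exact Ideal.mul_mem_right _ _ (primeBelow_mem 𝔭)

/-- Distinct maximal ideals are coprime, so their product divides `(x)`; then compare norms. -/
theorem prod_absNorm_le_natAbs_norm (S : Finset (HeightOneSpectrum (𝓞 K))) {x : 𝓞 K} (hx : x ≠ 0)
    (h : ∀ 𝔭 ∈ S, x ∈ 𝔭.asIdeal) :
    ∏ 𝔭 ∈ S, Ideal.absNorm 𝔭.asIdeal ≤ (Algebra.norm ℤ x).natAbs := by
  have hdvd : ∏ 𝔭 ∈ S, 𝔭.asIdeal ∣ Ideal.span {x} := by
    apply Finset.prod_dvd_of_coprime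
    · intro 𝔭 _ 𝔮 _ hne
      refine Ideal.isCoprime_of_isMaximal (fun he => hne ?_)
      exact HeightOneSpectrum.ext he
    · intro 𝔭 hp
      rw [Ideal.dvd_span_singleton]
      exact h 𝔭 hp
  rw [← Ideal.absNorm_span_singleton, ← map_prod]
  refine Nat.le_of_dvd (Nat.pos_of_ne_zero ?_) (map_dvd Ideal.absNorm hdvd)
  rwa [Ne, Ideal.absNorm_eq_zero_iff, Ideal.span_singleton_eq_bot]

theorem finite_primes_containing {x : 𝓞 K} (hx : x ≠ 0) :
    {𝔭 : HeightOneSpectrum (𝓞 K) | x ∈ 𝔭.asIdeal}.Finite := by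
  have hI : Ideal.span {x} ≠ ⊥ := by rwa [Ne, Ideal.span_singleton_eq_bot]
  refine (Ideal.finite_factors hI).subset fun 𝔭 h => ?_
  exact Ideal.dvd_span_singleton.2 h

theorem finite_primeBelow_le (y : ℝ) :
    {𝔭 : HeightOneSpectrum (𝓞 K) | (primeBelow 𝔭 : ℝ) ≤ y}.Finite := by
  -- Every prime in question contains this one nonzero integer.
  have h0 : ((⌊y⌋₊.factorial : ℕ) : 𝓞 K) ≠ 0 := by exact_mod_cast (Nat.factorial_ne_zero _)
  refine (finite_primes_containing h0).subset fun 𝔭 h => ?_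
  rw [Set.mem_ofPred_eq, natCast_mem_iff_primeBelow_dvd]
  exact Nat.dvd_factorial (primeBelow_prime 𝔭).pos (Nat.le_floor h)

/-- The norm of `q` is `q ^ k`, and each prime above `q` takes up a factor of at least `q`. -/
theorem card_primeBelow_eq_le (S : Finset (HeightOneSpectrum (𝓞 K))) (q : ℕ) :
    (S.filter fun 𝔭 => primeBelow 𝔭 = q).card ≤ Module.finrank ℚ K := by
  rcases (S.filter fun 𝔭 => primeBelow 𝔭 = q).eq_empty_or_nonempty with h | ⟨𝔭, h𝔭⟩
  · simp [h]
  have hq : q.Prime := (Finset.mem_filter.1 h𝔭).2 ▸ primeBelow_prime 𝔭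
  have h0 : (q : 𝓞 K) ≠ 0 := by exact_mod_cast hq.ne_zero
  have h1 := prod_absNorm_le_natAbs_norm (S.filter fun 𝔭 => primeBelow 𝔭 = q) h0 (fun 𝔭 h => by
    rw [natCast_mem_iff_primeBelow_dvd, (Finset.mem_filter.1 h).2])
  have h2 : (Algebra.norm ℤ (q : 𝓞 K)).natAbs = q ^ Module.finrank ℚ K := by
    have := Algebra.norm_algebraMap (S := 𝓞 K) (q : ℤ)
    rw [← RingOfIntegers.rank K]
    simp only [map_natCast] at this
    rw [this, Int.natAbs_pow, Int.natAbs_natCast]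
  rw [h2] at h1
  have h3 : q ^ (S.filter fun 𝔭 => primeBelow 𝔭 = q).card ≤
      ∏ 𝔭 ∈ S with primeBelow 𝔭 = q, Ideal.absNorm 𝔭.asIdeal := by
    rw [← Finset.prod_const]
    refine Finset.prod_le_prod' fun 𝔭 h => ?_
    rw [← (Finset.mem_filter.1 h).2]
    exact primeBelow_le_absNorm 𝔭
  exact (Nat.pow_le_pow_iff_right hq.one_lt).1 (h3.trans h1)

/-- Grouping the primes by the rational prime below, with at most `k` in each group, compares the
sum with `k * ∑ q, q ^ (-n)`. -/
theorem summable_absNorm_inv_pow {n : ℕ} (hn : 2 ≤ n) :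
    Summable fun 𝔭 : HeightOneSpectrum (𝓞 K) => ((Ideal.absNorm 𝔭.asIdeal : ℝ) ^ n)⁻¹ := by
  have hs : Summable fun q : ℕ => ((q : ℝ) ^ n)⁻¹ := Real.summable_nat_pow_inv.2 hn
  refine summable_of_sum_le (c := Module.finrank ℚ K * ∑' q : ℕ, ((q : ℝ) ^ n)⁻¹)
    (fun _ => by positivity) fun S => ?_
  classical
  calc ∑ 𝔭 ∈ S, ((Ideal.absNorm 𝔭.asIdeal : ℝ) ^ n)⁻¹
      ≤ ∑ 𝔭 ∈ S, ((primeBelow 𝔭 : ℝ) ^ n)⁻¹ := by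
        refine Finset.sum_le_sum fun 𝔭 _ => ?_
        have h0 : (0 : ℝ) < primeBelow 𝔭 := by exact_mod_cast (primeBelow_prime 𝔭).pos
        have h1 : (primeBelow 𝔭 : ℝ) ≤ Ideal.absNorm 𝔭.asIdeal := by
          exact_mod_cast primeBelow_le_absNorm 𝔭
        gcongr
    _ = ∑ q ∈ S.image primeBelow, ∑ 𝔭 ∈ S with primeBelow 𝔭 = q, ((primeBelow 𝔭 : ℝ) ^ n)⁻¹ :=
        (Finset.sum_fiberwise_of_maps_to (fun _ h => Finset.mem_image_of_mem _ h) _).symm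
    _ ≤ ∑ q ∈ S.image primeBelow, Module.finrank ℚ K * ((q : ℝ) ^ n)⁻¹ := by
        refine Finset.sum_le_sum fun q _ => ?_
        rw [Finset.sum_congr rfl (g := fun _ => ((q : ℝ) ^ n)⁻¹)
          (fun 𝔭 h => by rw [(Finset.mem_filter.1 h).2]), Finset.sum_const, nsmul_eq_mul]
        have : ((S.filter fun 𝔭 => primeBelow 𝔭 = q).card : ℝ) ≤ Module.finrank ℚ K := by
          exact_mod_cast card_primeBelow_eq_le S q
        gcongr
    _ = Module.finrank ℚ K * ∑ q ∈ S.image primeBelow, ((q : ℝ) ^ n)⁻¹ := by rw [Finset.mul_sum]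
    _ ≤ _ := by
        gcongr
        exact hs.sum_le_tsum _ fun _ _ => by positivity

theorem exists_prime (K : Type*) [Field K] [NumberField K] : Nonempty (HeightOneSpectrum (𝓞 K)) := by
  obtain ⟨M, hM⟩ := Ideal.exists_maximal (𝓞 K)
  exact ⟨⟨M, hM.isPrime, Ring.ne_bot_of_isMaximal_of_not_isField hM (RingOfIntegers.not_isField K)⟩⟩

end Primes

/-! ### Equidistribution of boxes in residue classes, and size bounds in boxes -/

section Boxes

open Filter Topology

/-- The count is `⌈A⌉ - ⌈B⌉` for two rationals with `A - B = 2 * H / Q`. -/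
theorem abs_card_Ico_residue_sub_le {Q : ℕ} (hQ : 0 < Q) (s : ZMod Q) (H : ℕ) :
    |(((Finset.Ico (-(H : ℤ)) H).filter fun a : ℤ => (a : ZMod Q) = s).card : ℝ) - 2 * H / Q| ≤ 1 := by
  have : NeZero Q := ⟨hQ.ne'⟩
  obtain ⟨v, rfl⟩ := ZMod.intCast_surjective s
  have h1 := Int.Ico_filter_modEq_card (-(H : ℤ)) H (r := (Q : ℤ)) (by exact_mod_cast hQ) v
  simp only [ZMod.intCast_eq_intCast_iff]
  set c := ((Finset.Ico (-(H : ℤ)) H).filter fun a : ℤ => a ≡ v [ZMOD (Q : ℤ)]).card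
  set A : ℚ := (((H : ℤ) : ℚ) - v) / ((Q : ℤ) : ℚ) with hA
  set B : ℚ := ((-(H : ℤ) : ℤ) - v : ℚ) / ((Q : ℤ) : ℚ) with hB
  have hQ' : (0 : ℚ) < Q := by exact_mod_cast hQ
  have hAB : A - B = 2 * H / Q := by
    rw [hA, hB]; push_cast; field_simp; ring
  have hBA : B ≤ A := by
    have : 0 ≤ A - B := by rw [hAB]; positivity
    linarith
  rw [max_eq_left (sub_nonneg.2 (Int.ceil_le_ceil hBA))] at h1
  have h2 : (c : ℚ) = (⌈A⌉ : ℚ) - ⌈B⌉ := by exact_mod_cast h1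
  have key : |(c : ℚ) - 2 * H / Q| ≤ 1 := by
    rw [h2, ← hAB, abs_le]
    have := Int.le_ceil A
    have := Int.le_ceil B
    have := Int.ceil_lt_add_one A
    have := Int.ceil_lt_add_one B
    constructor <;> linarith
  have key' : ((|(c : ℚ) - 2 * H / Q| : ℚ) : ℝ) ≤ 1 := by exact_mod_cast key
  simpa using key'

variable {K : Type*} [Field K] [NumberField K] {ι : Type*} [Fintype ι]

theorem card_index_eq_finrank (E : Module.Basis ι ℤ (𝓞 K)) : Fintype.card ι = Module.finrank ℚ K := by
  rw [← RingOfIntegers.rank K, Module.finrank_eq_card_basis E]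

theorem mem_box₁ (E : Module.Basis ι ℤ (𝓞 K)) (H : ℕ) (x : 𝓞 K) :
    x ∈ box₁ E H ↔ ∀ j, -(H : ℤ) ≤ E.repr x j ∧ E.repr x j < H := by
  classical
  simp only [box₁, Finset.mem_map, Fintype.mem_piFinset, Finset.mem_Ico]
  constructor
  · rintro ⟨a, ha, rfl⟩ j
    have : E.repr (E.equivFun.symm a) j = a j := by
      rw [← Module.Basis.equivFun_apply, LinearEquiv.apply_symm_apply]
    have h := ha j
    rw [← this] at h
    exact h
  · intro h
    exact ⟨E.equivFun x, fun j => by simpa using h j, E.equivFun.symm_apply_apply x⟩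

open scoped Classical in
theorem card_box₁_filter (E : Module.Basis ι ℤ (𝓞 K)) (H : ℕ) (p : 𝓞 K → Prop) :
    ((box₁ E H).filter p).card =
      ((Fintype.piFinset fun _ : ι => Finset.Ico (-(H : ℤ)) (H : ℤ)).filter
        fun a => p (E.equivFun.symm a)).card := by
  rw [box₁, Finset.filter_map, Finset.card_map]
  rfl

theorem card_box₁ (E : Module.Basis ι ℤ (𝓞 K)) (H : ℕ) :
    (box₁ E H).card = (2 * H) ^ Module.finrank ℚ K := by
  classical
  rw [box₁, Finset.card_map, Fintype.card_piFinset, Finset.prod_const, Finset.card_univ,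
    Int.card_Ico, card_index_eq_finrank E]
  congr 1
  omega

open scoped Classical in
theorem card_fiber_mul_card {G R : Type*} [AddGroup G] [AddGroup R] [Fintype G] [Fintype R]
    (φ : G →+ R) (hφ : Function.Surjective φ) (r : R) :
    (Finset.univ.filter fun g => φ g = r).card * Fintype.card R = Fintype.card G := by
  have h : ∀ r' : R, (Finset.univ.filter fun g => φ g = r').card =
      (Finset.univ.filter fun g => φ g = r).card := fun r' => by
    have := AddMonoidHom.card_fiber_eq_of_mem_range φ (x := r') (y := r) (hφ r') (hφ r)
    convert this
  have := Finset.card_eq_sum_card_fiberwise (f := φ) (s := (Finset.univ : Finset G))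
    (t := Finset.univ) (by simp)
  rw [Finset.sum_congr rfl (fun r' _ => h r')] at this
  rw [← Finset.card_univ (α := G), this, Finset.sum_const, smul_eq_mul, Finset.card_univ, mul_comm]

/-- The homomorphism on residue vectors modulo `Q` that is induced by a homomorphism to a group
of exponent dividing `Q`. -/
noncomputable def residueHom (E : Module.Basis ι ℤ (𝓞 K)) {R : Type*} [AddCommGroup R]
    (φ : 𝓞 K →+ R) (Q : ℕ) (hQ : ∀ r : R, Q • r = 0) : (ι → ZMod Q) →+ R :=
  ∑ j, (ZMod.lift Q ⟨(zmultiplesHom R) (φ (E j)), by simpa using hQ (φ (E j))⟩).comp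
    (Pi.evalAddMonoidHom (fun _ : ι => ZMod Q) j)

theorem residueHom_intCast (E : Module.Basis ι ℤ (𝓞 K)) {R : Type*} [AddCommGroup R]
    (φ : 𝓞 K →+ R) (Q : ℕ) (hQ : ∀ r : R, Q • r = 0) (a : ι → ℤ) :
    residueHom E φ Q hQ (fun j => (a j : ZMod Q)) = φ (E.equivFun.symm a) := by
  simp only [residueHom, Module.Basis.equivFun_symm_apply, map_sum, map_zsmul]
  simp

-- A homomorphism to a group killed by `Q` sees only the coordinates modulo `Q`, and the box is a
-- product of intervals; so the count splits over residue vectors into one-dimensional counts.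
open scoped Classical in
theorem card_box₁_fiber (E : Module.Basis ι ℤ (𝓞 K)) {R : Type*} [AddCommGroup R]
    (φ : 𝓞 K →+ R) (Q : ℕ) [NeZero Q] (hQ : ∀ r : R, Q • r = 0) (r : R) (H : ℕ) :
    ((box₁ E H).filter fun x => φ x = r).card =
      ∑ s : ι → ZMod Q with residueHom E φ Q hQ s = r,
        ∏ j, ((Finset.Ico (-(H : ℤ)) H).filter fun a : ℤ => (a : ZMod Q) = s j).card := by
  rw [card_box₁_filter]
  rw [Finset.card_eq_sum_card_fiberwise (f := fun a : ι → ℤ => fun j => (a j : ZMod Q))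
    (t := Finset.univ.filter fun s => residueHom E φ Q hQ s = r)]
  · refine Finset.sum_congr rfl fun s hs => ?_
    rw [← Fintype.card_piFinset]
    congr 1
    ext a
    simp only [Finset.mem_filter, Fintype.mem_piFinset, Finset.mem_univ, true_and] at hs ⊢
    constructor
    · rintro ⟨⟨h1, h2⟩, h3⟩ j
      exact ⟨h1 j, congrFun h3 j⟩
    · intro h
      have h3 : (fun j => (a j : ZMod Q)) = s := funext fun j => (h j).2
      exact ⟨⟨fun j => (h j).1, by rw [← residueHom_intCast E φ Q hQ, h3, hs]⟩, h3⟩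
  · intro a ha
    simp only [Finset.coe_filter, Set.mem_ofPred_eq, Finset.mem_univ, true_and] at ha ⊢
    rw [residueHom_intCast]
    exact ha.2

theorem residueHom_surjective (E : Module.Basis ι ℤ (𝓞 K)) {R : Type*} [AddCommGroup R]
    (φ : 𝓞 K →+ R) (Q : ℕ) (hQ : ∀ r : R, Q • r = 0) (hφ : Function.Surjective φ) :
    Function.Surjective (residueHom E φ Q hQ) := by
  intro r
  obtain ⟨x, rfl⟩ := hφ r
  exact ⟨fun j => (E.equivFun x j : ZMod Q), by
    rw [residueHom_intCast, LinearEquiv.symm_apply_apply]⟩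

open scoped Classical in
theorem card_residueHom_fiber (E : Module.Basis ι ℤ (𝓞 K)) {R : Type*} [AddCommGroup R] [Fintype R]
    (φ : 𝓞 K →+ R) (Q : ℕ) [NeZero Q] (hQ : ∀ r : R, Q • r = 0) (hφ : Function.Surjective φ) (r : R) :
    ((Finset.univ.filter fun s => residueHom E φ Q hQ s = r).card : ℝ) =
      (Q : ℝ) ^ Module.finrank ℚ K / Fintype.card R := by
  have h := card_fiber_mul_card (residueHom E φ Q hQ) (residueHom_surjective E φ Q hQ hφ) r
  rw [Fintype.card_fun, ZMod.card, card_index_eq_finrank E] at h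
  have h0 : (Fintype.card R : ℝ) ≠ 0 := by
    have : Nonempty R := ⟨0⟩
    exact_mod_cast Fintype.card_ne_zero
  rw [eq_div_iff h0]
  exact_mod_cast h

-- There are `Q ^ k / |R|` admissible residue vectors, each met at most `(2 * H / Q + 1) ^ k` times.
-- Being uniform in `H` and `Q`, this bound serves for moduli that grow with `H`.
open scoped Classical in
theorem card_box₁_fiber_le (E : Module.Basis ι ℤ (𝓞 K)) {R : Type*} [AddCommGroup R] [Fintype R]
    (φ : 𝓞 K →+ R) (Q : ℕ) (hQ0 : 0 < Q) (hQ : ∀ r : R, Q • r = 0) (hφ : Function.Surjective φ)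
    (r : R) (H : ℕ) :
    (((box₁ E H).filter fun x => φ x = r).card : ℝ) ≤
      (2 * H + Q) ^ Module.finrank ℚ K / Fintype.card R := by
  have : NeZero Q := ⟨hQ0.ne'⟩
  have hQ' : (0 : ℝ) < Q := by exact_mod_cast hQ0
  rw [card_box₁_fiber E φ Q hQ]
  push_cast
  calc _ ≤ ∑ s : ι → ZMod Q with residueHom E φ Q hQ s = r, ∏ _j : ι, ((2 * H + Q : ℝ) / Q) := by
        refine Finset.sum_le_sum fun s _ => Finset.prod_le_prod (fun _ _ => by positivity) fun j _ => ?_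
        have := (abs_le.1 (abs_card_Ico_residue_sub_le hQ0 (s j) H)).2
        rw [add_div, div_self hQ'.ne']
        linarith
    _ = _ := by
        rw [Finset.sum_const, nsmul_eq_mul, card_residueHom_fiber E φ Q hQ hφ, Finset.prod_const,
          Finset.card_univ, card_index_eq_finrank E, div_pow]
        field_simp

open scoped Classical in
theorem tendsto_card_box₁_fiber (E : Module.Basis ι ℤ (𝓞 K)) {R : Type*} [AddCommGroup R] [Fintype R]
    (φ : 𝓞 K →+ R) (hφ : Function.Surjective φ) (r : R) :
    Tendsto (fun H : ℕ => (((box₁ E H).filter fun x => φ x = r).card : ℝ) /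
      (2 * H) ^ Module.finrank ℚ K) atTop (𝓝 (1 / Fintype.card R)) := by
  obtain ⟨Q, hQ0, hQ⟩ : ∃ Q : ℕ, 0 < Q ∧ ∀ r : R, Q • r = 0 :=
    ⟨Fintype.card R, Fintype.card_pos_iff.2 ⟨0⟩, fun r => card_nsmul_eq_zero⟩
  have : NeZero Q := ⟨hQ0.ne'⟩
  have hQ' : (0 : ℝ) < Q := by exact_mod_cast hQ0
  have h1 : ∀ s : ZMod Q, Tendsto (fun H : ℕ =>
      (((Finset.Ico (-(H : ℤ)) H).filter fun a : ℤ => (a : ZMod Q) = s).card : ℝ) / (2 * H))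
      atTop (𝓝 (1 / Q)) := by
    intro s
    rw [tendsto_iff_norm_sub_tendsto_zero]
    refine squeeze_zero' (Eventually.of_forall fun _ => norm_nonneg _) ?_
      (tendsto_one_div_atTop_nhds_zero_nat (𝕜 := ℝ))
    filter_upwards [eventually_gt_atTop 0] with H hH
    have hH' : (0 : ℝ) < H := by exact_mod_cast hH
    have h2 := abs_card_Ico_residue_sub_le hQ0 s H
    set c : ℝ := (((Finset.Ico (-(H : ℤ)) H).filter fun a : ℤ => (a : ZMod Q) = s).card : ℝ)
    have h3 : c / (2 * H) - 1 / Q = (c - 2 * H / Q) / (2 * H) := by field_simp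
    rw [h3, Real.norm_eq_abs, abs_div, abs_of_pos (by positivity : (0 : ℝ) < 2 * H)]
    gcongr
    linarith
  have h2 : Tendsto (fun H : ℕ => ∑ s : ι → ZMod Q with residueHom E φ Q hQ s = r,
        ∏ j, ((((Finset.Ico (-(H : ℤ)) H).filter fun a : ℤ => (a : ZMod Q) = s j).card : ℝ) / (2 * H)))
      atTop (𝓝 (∑ s : ι → ZMod Q with residueHom E φ Q hQ s = r, ∏ _j : ι, (1 / (Q : ℝ)))) :=
    tendsto_finsetSum _ fun s _ => tendsto_finsetProd _ fun j _ => h1 (s j)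
  have h3 : ∑ s : ι → ZMod Q with residueHom E φ Q hQ s = r, ∏ _j : ι, (1 / (Q : ℝ)) =
      1 / Fintype.card R := by
    rw [Finset.sum_const, nsmul_eq_mul, card_residueHom_fiber E φ Q hQ hφ, Finset.prod_const,
      Finset.card_univ, card_index_eq_finrank E]
    field_simp
    rw [← mul_pow, mul_one_div_cancel hQ'.ne', one_pow]
  rw [h3] at h2
  refine h2.congr fun H => ?_
  rw [card_box₁_fiber E φ Q hQ]
  push_cast
  rw [Finset.sum_div]
  refine Finset.sum_congr rfl fun s _ => ?_
  rw [Finset.prod_div_distrib, Finset.prod_const, Finset.card_univ, card_index_eq_finrank E]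

open scoped Classical in
theorem tendsto_card_box₁_preimage (E : Module.Basis ι ℤ (𝓞 K)) {R : Type*} [AddCommGroup R]
    [Fintype R] (φ : 𝓞 K →+ R) (hφ : Function.Surjective φ) (D : Finset R) :
    Tendsto (fun H : ℕ => (((box₁ E H).filter fun x => φ x ∈ D).card : ℝ) /
      (2 * H) ^ Module.finrank ℚ K) atTop (𝓝 (D.card / Fintype.card R)) := by
  have h := tendsto_finsetSum D fun r _ => tendsto_card_box₁_fiber E φ hφ r
  rw [Finset.sum_const, nsmul_eq_mul, mul_one_div] at h
  refine h.congr fun H => ?_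
  rw [← Finset.sum_div, ← Nat.cast_sum]
  congr 2
  rw [Finset.card_eq_sum_card_fiberwise (f := φ) (t := D)]
  · refine Finset.sum_congr rfl fun r hr => ?_
    congr 1
    ext x
    simp only [Finset.mem_filter]
    constructor
    · rintro ⟨h1, rfl⟩; exact ⟨⟨h1, hr⟩, rfl⟩
    · rintro ⟨⟨h1, -⟩, h2⟩; exact ⟨h1, h2⟩
  · intro x hx
    exact (Finset.mem_filter.1 hx).2

/-- The norm is a product of `k` embeddings, each of size `O(H)` on the box. -/
theorem exists_natAbs_norm_le (E : Module.Basis ι ℤ (𝓞 K)) :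
    ∃ C : ℝ, 1 ≤ C ∧ ∀ H : ℕ, ∀ x ∈ box₁ E H,
      ((Algebra.norm ℤ x).natAbs : ℝ) ≤ C * (H : ℝ) ^ Module.finrank ℚ K := by
  set B : ℝ := 1 + ∑ σ : K →ₐ[ℚ] ℂ, ∑ j, ‖σ (E j)‖ with hB
  have hB1 : 1 ≤ B := by
    rw [hB]; linarith [Finset.sum_nonneg fun (σ : K →ₐ[ℚ] ℂ) (_ : σ ∈ Finset.univ) =>
      Finset.sum_nonneg fun (j : ι) (_ : j ∈ Finset.univ) => norm_nonneg (σ (E j))]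
  refine ⟨B ^ Module.finrank ℚ K, one_le_pow₀ hB1, fun H x hx => ?_⟩
  have h1 : ((Algebra.norm ℤ x).natAbs : ℝ) = ‖(algebraMap ℚ ℂ) (Algebra.norm ℚ (x : K))‖ := by
    rw [← Algebra.coe_norm_int]
    simp [Nat.cast_natAbs]
  rw [h1, Algebra.norm_eq_prod_embeddings ℚ ℂ (x : K), norm_prod]
  have h2 : ∀ σ : K →ₐ[ℚ] ℂ, ‖σ (x : K)‖ ≤ B * H := by
    intro σ
    have hx' : (x : K) = ∑ j, (E.repr x j : K) * (E j : K) := by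
      conv_lhs => rw [← E.sum_repr x]
      simp [map_sum]
    rw [hx', map_sum]
    calc ‖∑ j, σ ((E.repr x j : K) * (E j : K))‖ ≤ ∑ j, ‖σ ((E.repr x j : K) * (E j : K))‖ :=
          norm_sum_le _ _
      _ ≤ ∑ j, H * ‖σ (E j)‖ := by
          refine Finset.sum_le_sum fun j _ => ?_
          rw [map_mul, norm_mul, map_intCast, Complex.norm_intCast]
          gcongr
          have := (mem_box₁ E H x).1 hx j
          rw [abs_le]
          constructor
          · exact_mod_cast this.1
          · exact_mod_cast this.2.le
      _ = H * ∑ j, ‖σ (E j)‖ := by rw [Finset.mul_sum]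
      _ ≤ H * B := by
          gcongr
          rw [hB]
          have := Finset.single_le_sum (f := fun σ : K →ₐ[ℚ] ℂ => ∑ j, ‖σ (E j)‖)
            (fun σ _ => Finset.sum_nonneg fun j _ => norm_nonneg _) (Finset.mem_univ σ)
          linarith
      _ = B * H := mul_comm _ _
  calc ∏ σ : K →ₐ[ℚ] ℂ, ‖σ (x : K)‖ ≤ ∏ _σ : K →ₐ[ℚ] ℂ, (B * H) :=
        Finset.prod_le_prod (fun _ _ => norm_nonneg _) fun σ _ => h2 σ
    _ = _ := by
        rw [Finset.prod_const, Finset.card_univ, AlgHom.card, mul_pow]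

open scoped Classical in
/-- The elements of a large prime are sparse in a box. -/
theorem exists_card_box₁_inter_prime_le (E : Module.Basis ι ℤ (𝓞 K)) :
    ∃ C : ℝ, 0 ≤ C ∧ ∀ H : ℕ, 1 ≤ H → ∀ 𝔭 : HeightOneSpectrum (𝓞 K), H < primeBelow 𝔭 →
      (((box₁ E H).filter fun x => x ∈ 𝔭.asIdeal).card : ℝ) ≤
        C * (2 * H) ^ Module.finrank ℚ K / H := by
  obtain ⟨B, hB⟩ : ∃ B : ℕ, ∀ j, |E.repr 1 j| ≤ B :=
    ⟨∑ j, (E.repr 1 j).natAbs, fun j => by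
      rw [Int.abs_eq_natAbs]
      exact_mod_cast Finset.single_le_sum (f := fun j => (E.repr 1 j).natAbs)
        (fun _ _ => Nat.zero_le _) (Finset.mem_univ j)⟩
  -- The translates of `𝔭` by `0, …, H - 1` are disjoint, because a difference of two of these
  -- integers is smaller than `primeBelow 𝔭`. As `B` bounds the coordinates of `1`, the translated
  -- points stay in the box of size `(1 + B) * H`, so `H` times the count is at most the size of
  -- that box.
  refine ⟨(1 + B) ^ Module.finrank ℚ K, by positivity, fun H hH 𝔭 hp => ?_⟩
  have hH' : (0 : ℝ) < H := by exact_mod_cast hH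
  have h : (Finset.range H ×ˢ (box₁ E H).filter fun x => x ∈ 𝔭.asIdeal).card ≤
      (box₁ E ((1 + B) * H)).card := by
    apply Finset.card_le_card_of_injOn (fun z => z.2 + (z.1 : 𝓞 K))
    · rintro ⟨t, x⟩ hz
      simp only [Finset.coe_product, Set.mem_prod, Finset.mem_coe, Finset.mem_range,
        Finset.mem_filter] at hz ⊢
      obtain ⟨ht, hx, -⟩ := hz
      rw [mem_box₁] at hx ⊢
      intro j
      have h1 : E.repr (x + (t : 𝓞 K)) j = E.repr x j + t * E.repr 1 j := by
        have : (t : 𝓞 K) = (t : ℤ) • (1 : 𝓞 K) := by simp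
        rw [map_add, this, map_smul]
        simp
      have h2 : |(t : ℤ) * E.repr 1 j| ≤ H * B := by
        rw [abs_mul, Nat.abs_cast]
        exact mul_le_mul (by exact_mod_cast ht.le) (hB j) (abs_nonneg _) (by positivity)
      rw [h1]
      have h3 := hx j
      have h4 := abs_le.1 h2
      push_cast
      constructor <;> nlinarith
    · rintro ⟨t, x⟩ hz ⟨t', x'⟩ hz' heq
      simp only [Finset.coe_product, Set.mem_prod, Finset.mem_coe, Finset.mem_range,
        Finset.mem_filter] at hz hz' heq
      have key : ∀ (a b : ℕ) (u w : 𝓞 K), a < H → u ∈ 𝔭.asIdeal → w ∈ 𝔭.asIdeal →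
          u + (a : 𝓞 K) = w + (b : 𝓞 K) → a ≤ b := by
        intro a b u w ha hu hw he
        by_contra hab
        have h1 : ((a - b : ℕ) : 𝓞 K) ∈ 𝔭.asIdeal := by
          rw [Nat.cast_sub (by omega)]
          have : (a : 𝓞 K) - b = w - u := by linear_combination he
          rw [this]
          exact sub_mem hw hu
        rw [natCast_mem_iff_primeBelow_dvd] at h1
        have := Nat.le_of_dvd (by omega) h1
        omega
      have ht : t = t' := le_antisymm (key t t' x x' hz.1 hz.2.2 hz'.2.2 heq)
        (key t' t x' x hz'.1 hz'.2.2 hz.2.2 heq.symm)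
      subst ht
      simpa using heq
  rw [Finset.card_product, Finset.card_range, card_box₁] at h
  rw [le_div_iff₀ hH', mul_comm]
  calc (H : ℝ) * _ ≤ (2 * ((1 + B) * H)) ^ Module.finrank ℚ K := by exact_mod_cast h
    _ = _ := by rw [← mul_pow]; congr 1; ring

end Boxes

/-! ### The Eisenstein condition modulo `𝔭 ^ 2` -/

section Local

variable {K : Type*} [Field K] [NumberField K]

noncomputable instance instFintypeQuotientPow (𝔭 : HeightOneSpectrum (𝓞 K)) (e : ℕ) :
    Fintype (𝓞 K ⧸ 𝔭.asIdeal ^ e) :=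
  have : Finite (𝓞 K ⧸ 𝔭.asIdeal ^ e) :=
    (𝔭.asIdeal ^ e).finiteQuotientOfFreeOfNeBot (pow_ne_zero e 𝔭.ne_bot)
  Fintype.ofFinite _

theorem card_quotient_pow (𝔭 : HeightOneSpectrum (𝓞 K)) (e : ℕ) :
    Fintype.card (𝓞 K ⧸ 𝔭.asIdeal ^ e) = Ideal.absNorm 𝔭.asIdeal ^ e := by
  rw [← map_pow, Ideal.absNorm_apply, Submodule.cardQuot_apply, Nat.card_eq_fintype_card]

/-- The reduction of `𝓞 K` modulo the `e`-th powers of the primes in `S`. -/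
noncomputable def reduction (S : Finset (HeightOneSpectrum (𝓞 K))) (e : ℕ) :
    𝓞 K →+ ∀ 𝔭 : S, 𝓞 K ⧸ 𝔭.1.asIdeal ^ e :=
  (RingHom.pi fun 𝔭 : S => Ideal.Quotient.mk (𝔭.1.asIdeal ^ e)).toAddMonoidHom

theorem reduction_apply (S : Finset (HeightOneSpectrum (𝓞 K))) (e : ℕ) (x : 𝓞 K) (𝔭 : S) :
    reduction S e x 𝔭 = Ideal.Quotient.mk (𝔭.1.asIdeal ^ e) x := rfl

/-- The Chinese remainder theorem; this is what makes conditions at different primes independent. -/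
theorem reduction_surjective (S : Finset (HeightOneSpectrum (𝓞 K))) (e : ℕ) :
    Function.Surjective (reduction S e) := by
  intro r
  obtain ⟨x, hx⟩ := Ideal.pi_quotient_surjective (I := fun 𝔭 : S => 𝔭.1.asIdeal ^ e)
    (fun 𝔭 𝔮 hne => IsCoprime.pow (Ideal.isCoprime_of_isMaximal fun he =>
      hne (Subtype.ext (HeightOneSpectrum.ext he)))) r
  exact ⟨x, funext hx⟩

/-- The condition that `𝔭`-Eisenstein polynomials satisfy at the coefficient with index `i`. -/
def CoeffCondition {d : ℕ} (𝔭 : HeightOneSpectrum (𝓞 K)) (i : Fin (d + 1)) (x : 𝓞 K) : Prop :=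
  if i = Fin.last d then x ∉ 𝔭.asIdeal else if i = 0 then x ∈ 𝔭.asIdeal ∧ x ∉ 𝔭.asIdeal ^ 2
    else x ∈ 𝔭.asIdeal

theorem isEisensteinAt_iff_coeffCondition {d : ℕ} (hd : d ≠ 0) (𝔭 : HeightOneSpectrum (𝓞 K))
    (a : Fin (d + 1) → 𝓞 K) : IsEisensteinAt 𝔭 a ↔ ∀ i, CoeffCondition 𝔭 i (a i) := by
  have h0 : (0 : Fin (d + 1)) ≠ Fin.last d := by
    rw [Ne, Fin.ext_iff]; simpa using hd.symm
  constructor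
  · rintro ⟨h1, h2, h3⟩ i
    unfold CoeffCondition
    split_ifs with hl hz
    · exact hl ▸ h1
    · exact ⟨h3 i hl, hz ▸ h2⟩
    · exact h3 i hl
  · intro h
    refine ⟨by simpa [CoeffCondition] using h (Fin.last d), ?_, fun i hi => ?_⟩
    · have := h 0
      rw [CoeffCondition, if_neg h0, if_pos rfl] at this
      exact this.2
    · have := h i
      rw [CoeffCondition, if_neg hi] at this
      split_ifs at this
      exacts [this.1, this]

open scoped Classical in
/-- The residues modulo `𝔭 ^ 2` that satisfy the `i`-th coefficient condition. -/
noncomputable def coeffResidues {d : ℕ} (𝔭 : HeightOneSpectrum (𝓞 K)) (i : Fin (d + 1)) :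
    Finset (𝓞 K ⧸ 𝔭.asIdeal ^ 2) :=
  let P : Finset (𝓞 K ⧸ 𝔭.asIdeal ^ 2) := Finset.univ.filter fun r =>
    Ideal.Quotient.factor (Ideal.pow_le_pow_right (I := 𝔭.asIdeal) one_le_two) r = 0
  if i = Fin.last d then Pᶜ else if i = 0 then P.erase 0 else P

theorem mk_mem_coeffResidues {d : ℕ} (𝔭 : HeightOneSpectrum (𝓞 K)) (i : Fin (d + 1)) (x : 𝓞 K) :
    Ideal.Quotient.mk (𝔭.asIdeal ^ 2) x ∈ coeffResidues 𝔭 i ↔ CoeffCondition 𝔭 i x := by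
  unfold coeffResidues CoeffCondition
  split_ifs <;> simp [Ideal.Quotient.eq_zero_iff_mem, and_comm]

/-- The proportion of the elements that satisfy the `i`-th coefficient condition. -/
noncomputable def coeffDensity {d : ℕ} (𝔭 : HeightOneSpectrum (𝓞 K)) (i : Fin (d + 1)) : ℝ :=
  (coeffResidues 𝔭 i).card / (Ideal.absNorm 𝔭.asIdeal : ℝ) ^ 2

theorem card_maximal_residues (𝔭 : HeightOneSpectrum (𝓞 K)) [DecidablePred fun r : 𝓞 K ⧸ 𝔭.asIdeal ^ 2 =>
      Ideal.Quotient.factor (Ideal.pow_le_pow_right (I := 𝔭.asIdeal) one_le_two) r = 0] :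
    (Finset.univ.filter fun r : 𝓞 K ⧸ 𝔭.asIdeal ^ 2 =>
      Ideal.Quotient.factor (Ideal.pow_le_pow_right (I := 𝔭.asIdeal) one_le_two) r = 0).card =
      Ideal.absNorm 𝔭.asIdeal := by
  have h := card_fiber_mul_card
    (Ideal.Quotient.factor (Ideal.pow_le_pow_right (I := 𝔭.asIdeal) one_le_two)).toAddMonoidHom
    (Ideal.Quotient.factor_surjective
      (Ideal.pow_le_pow_right (I := 𝔭.asIdeal) one_le_two)) 0
  rw [card_quotient_pow, card_quotient_pow] at h
  have cancel : ∀ c N : ℕ, 0 < N → c * N ^ 1 = N ^ 2 → c = N := fun c N hN hc =>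
    Nat.eq_of_mul_eq_mul_right hN (by rwa [pow_one, sq] at hc)
  have h' := cancel _ _ (absNorm_pos 𝔭) h
  convert h'
  rfl

/-- With `N` the norm of `𝔭`, of the `N ^ 2` residues modulo `𝔭 ^ 2` the leading coefficient may
take `N ^ 2 - N`, the constant one `N - 1`, and each of the `d - 1` others `N`. -/
theorem prod_coeffDensity {d : ℕ} (hd : 2 ≤ d) (𝔭 : HeightOneSpectrum (𝓞 K)) :
    ∏ i : Fin (d + 1), coeffDensity 𝔭 i = eisensteinWeight d 𝔭 := by
  classical
  obtain ⟨d, rfl⟩ := Nat.exists_eq_add_of_le' hd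
  have hN : (Ideal.absNorm 𝔭.asIdeal : ℝ) ≠ 0 := by exact_mod_cast (absNorm_pos 𝔭).ne'
  have h1 : coeffDensity 𝔭 (Fin.last (d + 2)) =
      ((Ideal.absNorm 𝔭.asIdeal : ℝ) ^ 2 - Ideal.absNorm 𝔭.asIdeal) / (Ideal.absNorm 𝔭.asIdeal : ℝ) ^ 2 := by
    rw [coeffDensity, coeffResidues, if_pos rfl, Finset.card_compl, card_maximal_residues,
      card_quotient_pow, Nat.cast_sub (Nat.le_self_pow two_ne_zero _), Nat.cast_pow]
  have h2 : coeffDensity 𝔭 (0 : Fin (d + 2 + 1)) =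
      ((Ideal.absNorm 𝔭.asIdeal : ℝ) - 1) / (Ideal.absNorm 𝔭.asIdeal : ℝ) ^ 2 := by
    rw [coeffDensity, coeffResidues, if_neg (by simp [Fin.ext_iff]), if_pos rfl,
      Finset.card_erase_of_mem (by simp), card_maximal_residues, Nat.cast_sub (absNorm_pos 𝔭),
      Nat.cast_one]
  have h3 : ∀ i : Fin (d + 1), coeffDensity 𝔭 i.succ.castSucc =
      (Ideal.absNorm 𝔭.asIdeal : ℝ) / (Ideal.absNorm 𝔭.asIdeal : ℝ) ^ 2 := fun i => by
    rw [coeffDensity, coeffResidues, if_neg (by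
        rw [Fin.ext_iff]; simp only [Fin.val_castSucc, Fin.val_succ, Fin.val_last]; omega),
      if_neg (by
        rw [Fin.ext_iff]; simp only [Fin.val_castSucc, Fin.val_succ, Fin.val_zero]; omega),
      card_maximal_residues]
  rw [Fin.prod_univ_castSucc, Fin.prod_univ_succ, h1, Fin.castSucc_zero, h2,
    Finset.prod_congr rfl (fun i _ => h3 i), Finset.prod_const, Finset.card_univ, Fintype.card_fin,
    eisensteinWeight]
  rw [show (Ideal.absNorm 𝔭.asIdeal : ℝ) / (Ideal.absNorm 𝔭.asIdeal : ℝ) ^ 2 =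
    (Ideal.absNorm 𝔭.asIdeal : ℝ)⁻¹ by field_simp, inv_pow]
  field_simp
  ring

end Local

/-! ### Frequencies of Eisenstein conditions in a box: limits and uniform bounds -/

section Counting

open Filter Topology

variable {K : Type*} [Field K] [NumberField K] {ι : Type*} [Fintype ι] {d : ℕ}

theorem boxSize_succ (d H : ℕ) : boxSize K (d + 1) H =
    ∏ _i : Fin (d + 1), (2 * (H : ℝ)) ^ Module.finrank ℚ K := by
  rw [boxSize, pow_mul, Finset.prod_const, Finset.card_univ, Fintype.card_fin]

theorem boxSize_pos (m : ℕ) {H : ℕ} (hH : 1 ≤ H) : 0 < boxSize K m H := by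
  have : (0 : ℝ) < H := by exact_mod_cast hH
  unfold boxSize
  positivity

theorem boxSize_nonneg (m H : ℕ) : 0 ≤ boxSize K m H := by
  unfold boxSize
  positivity

theorem card_box (E : Module.Basis ι ℤ (𝓞 K)) (m H : ℕ) : ((box E m H).card : ℝ) = boxSize K m H := by
  rw [box, Fintype.card_piFinset, Finset.prod_const, Finset.card_univ, Fintype.card_fin, card_box₁,
    boxSize, pow_mul]
  push_cast
  rfl

open scoped Classical in
theorem card_box_eisenstein (E : Module.Basis ι ℤ (𝓞 K)) (hd : d ≠ 0)
    (S : Finset (HeightOneSpectrum (𝓞 K))) (H : ℕ) :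
    ((box E (d + 1) H).filter fun A => ∀ 𝔭 ∈ S, IsEisensteinAt 𝔭 A).card =
      ∏ i : Fin (d + 1), ((box₁ E H).filter fun x => ∀ 𝔭 ∈ S, CoeffCondition 𝔭 i x).card := by
  rw [← Fintype.card_piFinset]
  congr 1
  ext A
  simp only [box, Finset.mem_filter, Fintype.mem_piFinset, isEisensteinAt_iff_coeffCondition hd]
  constructor
  · rintro ⟨h1, h2⟩ i
    exact ⟨h1 i, fun 𝔭 h𝔭 => h2 𝔭 h𝔭 i⟩
  · intro h
    exact ⟨fun i => (h i).1, fun 𝔭 h𝔭 i => (h i).2 𝔭 h𝔭⟩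

-- The conditions factor over coefficients, and for each coefficient over the primes of `S`;
-- exchanging the two products gives the weights.
open scoped Classical in
theorem tendsto_card_box_eisenstein (E : Module.Basis ι ℤ (𝓞 K)) (hd : 2 ≤ d)
    (S : Finset (HeightOneSpectrum (𝓞 K))) :
    Tendsto (fun H : ℕ => (((box E (d + 1) H).filter fun A => ∀ 𝔭 ∈ S, IsEisensteinAt 𝔭 A).card : ℝ) /
      boxSize K (d + 1) H) atTop (𝓝 (∏ 𝔭 ∈ S, eisensteinWeight d 𝔭)) := by
  have h : ∀ i : Fin (d + 1), Tendsto (fun H : ℕ =>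
      (((box₁ E H).filter fun x => ∀ 𝔭 ∈ S, CoeffCondition 𝔭 i x).card : ℝ) /
        (2 * H) ^ Module.finrank ℚ K) atTop (𝓝 (∏ 𝔭 ∈ S, coeffDensity 𝔭 i)) := by
    intro i
    have := tendsto_card_box₁_preimage E (reduction S 2) (reduction_surjective S 2)
      (Fintype.piFinset fun 𝔭 : S => coeffResidues 𝔭.1 i)
    convert this using 5
    · rename_i H x
      simp [Fintype.mem_piFinset, reduction_apply, mk_mem_coeffResidues]
    · rw [Fintype.card_piFinset, Fintype.card_pi]
      simp only [card_quotient_pow]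
      push_cast
      rw [← Finset.prod_div_distrib, ← Finset.prod_coe_sort]
      rfl
  have h2 := tendsto_finsetProd Finset.univ fun i _ => h i
  rw [Finset.prod_comm, Finset.prod_congr rfl (fun 𝔭 _ => prod_coeffDensity hd 𝔭)] at h2
  refine h2.congr fun H => ?_
  rw [card_box_eisenstein E (by omega), boxSize_succ, Finset.prod_div_distrib]
  push_cast
  rfl

/-- The summable majorant of the frequencies of the Eisenstein conditions. -/
noncomputable def majorant (d : ℕ) (𝔭 : HeightOneSpectrum (𝓞 K)) : ℝ :=
  (2 ^ Module.finrank ℚ K) ^ d * ((Ideal.absNorm 𝔭.asIdeal : ℝ) ^ d)⁻¹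

theorem majorant_nonneg (𝔭 : HeightOneSpectrum (𝓞 K)) : 0 ≤ majorant d 𝔭 := by
  unfold majorant
  positivity

theorem summable_majorant (hd : 2 ≤ d) :
    Summable fun 𝔭 : HeightOneSpectrum (𝓞 K) => majorant d 𝔭 :=
  (summable_absNorm_inv_pow hd).mul_left _

theorem mem_of_coeffCondition {𝔭 : HeightOneSpectrum (𝓞 K)} {i : Fin (d + 1)} {x : 𝓞 K}
    (hi : i ≠ Fin.last d) (h : CoeffCondition 𝔭 i x) : x ∈ 𝔭.asIdeal := by
  rw [CoeffCondition, if_neg hi] at h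
  split_ifs at h
  exacts [h.1, h]

-- Reducing modulo first powers only keeps the exponent of the quotient a divisor of `Q = ∏ 𝔭 ∈ S,
-- primeBelow 𝔭`. Since `Q ≤ H`, one has `2 * H + Q ≤ 2 * (2 * H)`, whence the factor `2 ^ k`.
open scoped Classical in
theorem card_box₁_inter_primes_le (E : Module.Basis ι ℤ (𝓞 K))
    (S : Finset (HeightOneSpectrum (𝓞 K))) (H : ℕ) (hS : ∏ 𝔭 ∈ S, primeBelow 𝔭 ≤ H) :
    (((box₁ E H).filter fun x => ∀ 𝔭 ∈ S, x ∈ 𝔭.asIdeal).card : ℝ) ≤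
      (2 * H) ^ Module.finrank ℚ K *
        (2 ^ Module.finrank ℚ K * (∏ 𝔭 ∈ S, (Ideal.absNorm 𝔭.asIdeal : ℝ))⁻¹) := by
  have h := card_box₁_fiber_le E (reduction S 1) (∏ 𝔭 ∈ S, primeBelow 𝔭)
    (Finset.prod_pos fun 𝔭 _ => (primeBelow_prime 𝔭).pos) ?_ (reduction_surjective S 1) 0 H
  · have h1 : (Fintype.card (∀ 𝔭 : S, 𝓞 K ⧸ 𝔭.1.asIdeal ^ 1) : ℝ) =
        ∏ 𝔭 ∈ S, (Ideal.absNorm 𝔭.asIdeal : ℝ) := by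
      rw [Fintype.card_pi]
      simp only [card_quotient_pow, pow_one]
      push_cast
      exact Finset.prod_coe_sort S fun 𝔭 => (Ideal.absNorm 𝔭.asIdeal : ℝ)
    rw [h1] at h
    have h2 : ((∏ 𝔭 ∈ S, primeBelow 𝔭 : ℕ) : ℝ) ≤ H := by exact_mod_cast hS
    have h3 : ∀ x : 𝓞 K, reduction S 1 x = 0 ↔ ∀ 𝔭 ∈ S, x ∈ 𝔭.asIdeal := by
      intro x
      simp only [funext_iff, reduction_apply, Pi.zero_apply, Ideal.Quotient.eq_zero_iff_mem, pow_one,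
        Subtype.forall]
    simp only [h3] at h
    refine h.trans ?_
    rw [div_eq_mul_inv, ← mul_assoc, ← mul_pow]
    gcongr
    linarith
  · intro r
    funext 𝔭
    obtain ⟨x, hx⟩ := Ideal.Quotient.mk_surjective (r 𝔭)
    rw [Pi.smul_apply, ← hx, ← map_nsmul, Pi.zero_apply, Ideal.Quotient.eq_zero_iff_mem, pow_one,
      nsmul_eq_mul]
    refine Ideal.mul_mem_right _ _ ?_
    rw [natCast_mem_iff_primeBelow_dvd]
    exact Finset.dvd_prod_of_mem _ 𝔭.2

-- Only the membership in `𝔭` of the `d` lower coefficients is used; the leading coefficient is left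
-- free. The decay `N(𝔭) ^ (-d)` is already summable.
open scoped Classical in
theorem card_box_eisenstein_le (E : Module.Basis ι ℤ (𝓞 K)) (hd : d ≠ 0)
    (S : Finset (HeightOneSpectrum (𝓞 K))) (hne : S.Nonempty) (H : ℕ)
    (hS : ∏ 𝔭 ∈ S, primeBelow 𝔭 ≤ H) :
    (((box E (d + 1) H).filter fun A => ∀ 𝔭 ∈ S, IsEisensteinAt 𝔭 A).card : ℝ) ≤
      boxSize K (d + 1) H * ∏ 𝔭 ∈ S, majorant d 𝔭 := by
  rw [card_box_eisenstein E hd, boxSize_succ, Fin.prod_univ_castSucc, Fin.prod_univ_castSucc]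
  push_cast
  have h1 : ∀ i : Fin d,
      (((box₁ E H).filter fun x => ∀ 𝔭 ∈ S, CoeffCondition 𝔭 i.castSucc x).card : ℝ) ≤
      (2 * H) ^ Module.finrank ℚ K *
        (2 ^ Module.finrank ℚ K * (∏ 𝔭 ∈ S, (Ideal.absNorm 𝔭.asIdeal : ℝ))⁻¹) := fun i => by
    refine le_trans ?_ (card_box₁_inter_primes_le E S H hS)
    gcongr with x hx 𝔭
    exact mem_of_coeffCondition (Fin.castSucc_lt_last i).ne
  have h2 : (((box₁ E H).filter fun x => ∀ 𝔭 ∈ S, CoeffCondition 𝔭 (Fin.last d) x).card : ℝ) ≤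
      (2 * H) ^ Module.finrank ℚ K := by
    refine le_trans (Nat.cast_le.2 (Finset.card_filter_le _ _)) ?_
    rw [card_box₁]
    push_cast
    rfl
  -- The constant is lost once, but `majorant` pays it for each prime of the nonempty set `S`.
  have h3 : ((2 : ℝ) ^ Module.finrank ℚ K) ^ d ≤ ∏ _𝔭 ∈ S, ((2 : ℝ) ^ Module.finrank ℚ K) ^ d := by
    rw [Finset.prod_const]
    exact le_self_pow₀ (one_le_pow₀ (one_le_pow₀ one_le_two)) hne.card_pos.ne'
  calc _ ≤ (∏ _i : Fin d, ((2 * (H : ℝ)) ^ Module.finrank ℚ K *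
        (2 ^ Module.finrank ℚ K * (∏ 𝔭 ∈ S, (Ideal.absNorm 𝔭.asIdeal : ℝ))⁻¹))) *
          (2 * H) ^ Module.finrank ℚ K := by
        gcongr with i
        exact h1 i
    _ = (∏ _i : Fin d, (2 * (H : ℝ)) ^ Module.finrank ℚ K) * (2 * H) ^ Module.finrank ℚ K *
        (((2 : ℝ) ^ Module.finrank ℚ K) ^ d * ∏ 𝔭 ∈ S, ((Ideal.absNorm 𝔭.asIdeal : ℝ) ^ d)⁻¹) := by
        rw [Finset.prod_mul_distrib, Finset.prod_const (_ * _), Finset.card_univ, Fintype.card_fin,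
          mul_pow (2 ^ Module.finrank ℚ K) (_⁻¹), Finset.prod_inv_distrib, Finset.prod_pow S d, inv_pow]
        ring
    _ ≤ _ := by
        simp only [majorant, Finset.prod_mul_distrib]
        gcongr

/-- The norm of `x` is at most `C * H ^ k`. Among `n * k + t` such primes, `n * k` already have
norms with product at least `H ^ k`, and the other `t` contribute at least `2 ^ t > C`. -/
theorem exists_card_large_primes_lt (E : Module.Basis ι ℤ (𝓞 K)) {n : ℕ} (hn : 1 ≤ n) :
    ∃ c : ℕ, ∀ H : ℕ, 1 ≤ H → ∀ x ∈ box₁ E H, x ≠ 0 →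
      ∀ S : Finset (HeightOneSpectrum (𝓞 K)),
        (∀ 𝔭 ∈ S, (H : ℝ) ^ (1 / n : ℝ) < primeBelow 𝔭 ∧ x ∈ 𝔭.asIdeal) → S.card < c := by
  classical
  obtain ⟨C, hC1, hC⟩ := exists_natAbs_norm_le E
  obtain ⟨t, ht⟩ := pow_unbounded_of_one_lt C (one_lt_two : (1 : ℝ) < 2)
  refine ⟨n * Module.finrank ℚ K + t, fun H hH x hx hx0 S hS => ?_⟩
  by_contra! hcard
  have hH' : (0 : ℝ) < H := by exact_mod_cast hH
  obtain ⟨T, hTS, hT⟩ := Finset.exists_subset_card_eq (le_of_add_le_left hcard)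
  have h1 : ((∏ 𝔭 ∈ S, Ideal.absNorm 𝔭.asIdeal : ℕ) : ℝ) ≤ C * (H : ℝ) ^ Module.finrank ℚ K :=
    (Nat.cast_le.2 (prod_absNorm_le_natAbs_norm S hx0 fun 𝔭 h => (hS 𝔭 h).2)).trans (hC H x hx)
  have hq : ∀ 𝔭 : HeightOneSpectrum (𝓞 K), (primeBelow 𝔭 : ℝ) ≤ Ideal.absNorm 𝔭.asIdeal := fun 𝔭 => by
    exact_mod_cast primeBelow_le_absNorm 𝔭
  have h2 : (H : ℝ) ^ Module.finrank ℚ K ≤ ∏ 𝔭 ∈ T, (Ideal.absNorm 𝔭.asIdeal : ℝ) := by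
    calc (H : ℝ) ^ Module.finrank ℚ K = ∏ _𝔭 ∈ T, (H : ℝ) ^ (1 / n : ℝ) := by
          rw [Finset.prod_const, hT, pow_mul, ← Real.rpow_natCast _ n, ← Real.rpow_mul hH'.le,
            one_div_mul_cancel (by positivity), Real.rpow_one]
      _ ≤ _ := Finset.prod_le_prod (fun _ _ => by positivity) fun 𝔭 h =>
          (hS 𝔭 (hTS h)).1.le.trans (hq 𝔭)
  have h3 : (2 : ℝ) ^ t ≤ ∏ 𝔭 ∈ S \ T, (Ideal.absNorm 𝔭.asIdeal : ℝ) := by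
    calc (2 : ℝ) ^ t ≤ 2 ^ (S \ T).card := by
          refine pow_le_pow_right₀ one_le_two ?_
          rw [Finset.card_sdiff_of_subset hTS]
          omega
      _ = ∏ _𝔭 ∈ S \ T, (2 : ℝ) := by rw [Finset.prod_const]
      _ ≤ _ := Finset.prod_le_prod (fun _ _ => by positivity) fun 𝔭 h => by
          exact_mod_cast two_le_absNorm 𝔭
  push_cast at h1
  rw [← Finset.prod_sdiff hTS] at h1
  have h4 : (2 : ℝ) ^ t * (H : ℝ) ^ Module.finrank ℚ K ≤ C * (H : ℝ) ^ Module.finrank ℚ K :=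
    (mul_le_mul h3 h2 (by positivity) (by positivity)).trans h1
  exact absurd (le_of_mul_le_mul_right h4 (by positivity)) (not_le.2 ht)

theorem IsEisensteinAt.zero_mem (hd : d ≠ 0) {𝔭 : HeightOneSpectrum (𝓞 K)} {A : Fin (d + 1) → 𝓞 K}
    (h : IsEisensteinAt 𝔭 A) : A 0 ∈ 𝔭.asIdeal :=
  h.2.2 0 (by rw [Ne, Fin.ext_iff]; simpa using hd.symm)

theorem IsEisensteinAt.zero_ne_zero {𝔭 : HeightOneSpectrum (𝓞 K)} {A : Fin (d + 1) → 𝓞 K}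
    (h : IsEisensteinAt 𝔭 A) : A 0 ≠ 0 :=
  fun h0 => h.2.1 (h0 ▸ Submodule.zero_mem _)

/-- An Eisenstein prime contains the constant coefficient, which is nonzero because it avoids `𝔭 ^
2`. So the exceptional set of the system is empty. -/
theorem finite_eisensteinAt (hd : d ≠ 0) (A : Fin (d + 1) → 𝓞 K) :
    {𝔭 : HeightOneSpectrum (𝓞 K) | IsEisensteinAt 𝔭 A}.Finite := by
  by_cases h0 : A 0 = 0
  · convert Set.finite_empty
    exact Set.eq_empty_of_forall_notMem fun 𝔭 h => h.zero_ne_zero h0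
  · exact (finite_primes_containing h0).subset fun 𝔭 h => h.zero_mem hd

-- For fixed `𝔭` the linear coefficient lies in `𝔭` with frequency `O(1 / H)`. Summing over `𝔭`
-- after fixing the constant coefficient costs only a bounded factor, as a nonzero element of the
-- box lies in boundedly many primes of `W`. No summability over `W` is needed.
open scoped Classical in
theorem exists_sum_card_large_primes_le (E : Module.Basis ι ℤ (𝓞 K)) (hd : 2 ≤ d) :
    ∃ C : ℝ, 0 ≤ C ∧ ∀ H : ℕ, 1 ≤ H → ∀ W : Finset (HeightOneSpectrum (𝓞 K)),
      (∀ 𝔭 ∈ W, H < primeBelow 𝔭) →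
      ∑ 𝔭 ∈ W, (((box E (d + 1) H).filter fun A => IsEisensteinAt 𝔭 A).card : ℝ) ≤
        boxSize K (d + 1) H * (C / H) := by
  obtain ⟨c, hc⟩ := exists_card_large_primes_lt E le_rfl
  obtain ⟨C, hC0, hC⟩ := exists_card_box₁_inter_prime_le E
  obtain ⟨d, rfl⟩ := Nat.exists_eq_add_of_le' hd
  refine ⟨c * C, by positivity, fun H hH W hW => ?_⟩
  have hH' : (0 : ℝ) < H := by exact_mod_cast hH
  set V : ℝ := (2 * (H : ℝ)) ^ Module.finrank ℚ K with hV
  have hVc : ((box₁ E H).card : ℝ) = V := by rw [card_box₁]; push_cast; rfl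
  have h1 : ∀ 𝔭 ∈ W, (((box E (d + 2 + 1) H).filter fun A => IsEisensteinAt 𝔭 A).card : ℝ) ≤
      ∑ x ∈ box₁ E H with x ≠ 0, if x ∈ 𝔭.asIdeal then C * V / H * V ^ (d + 1) else 0 := by
    intro 𝔭 h𝔭
    -- Only the coefficients of index `0` and `1` are constrained; degree at least two ensures that
    -- index `1` is not the leading one.
    have hsub : ((box E (d + 2 + 1) H).filter fun A => IsEisensteinAt 𝔭 A) ⊆
        Fintype.piFinset (Fin.cons ((box₁ E H).filter fun x => x ≠ 0 ∧ x ∈ 𝔭.asIdeal)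
          (Fin.cons ((box₁ E H).filter fun x => x ∈ 𝔭.asIdeal) fun _ => box₁ E H)) := by
      intro A hA
      rw [Finset.mem_filter, box, Fintype.mem_piFinset] at hA
      rw [Fintype.mem_piFinset]
      intro i
      refine Fin.cases ?_ (fun i => ?_) i
      · rw [Fin.cons_zero, Finset.mem_filter]
        exact ⟨hA.1 0, hA.2.zero_ne_zero, hA.2.zero_mem (by omega)⟩
      · rw [Fin.cons_succ]
        refine Fin.cases ?_ (fun i => ?_) i
        · rw [Fin.cons_zero, Finset.mem_filter]
          exact ⟨hA.1 _, hA.2.2.2 _ (by simp [Fin.ext_iff])⟩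
        · rw [Fin.cons_succ]
          exact hA.1 _
    refine (Nat.cast_le.2 (Finset.card_le_card hsub)).trans ?_
    rw [Fintype.card_piFinset, Fin.prod_univ_succ, Fin.prod_univ_succ]
    simp only [Fin.cons_zero, Fin.cons_succ]
    rw [← Finset.sum_filter, Finset.sum_const, nsmul_eq_mul, Finset.filter_filter]
    push_cast
    rw [Finset.prod_const, Finset.card_univ, Fintype.card_fin, hVc]
    gcongr
    exact hC H hH 𝔭 (hW 𝔭 h𝔭)
  calc _ ≤ ∑ 𝔭 ∈ W, ∑ x ∈ box₁ E H with x ≠ 0,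
        if x ∈ 𝔭.asIdeal then C * V / H * V ^ (d + 1) else 0 := Finset.sum_le_sum h1
    _ = ∑ x ∈ box₁ E H with x ≠ 0, ((W.filter fun 𝔭 => x ∈ 𝔭.asIdeal).card : ℝ) *
        (C * V / H * V ^ (d + 1)) := by
        rw [Finset.sum_comm]
        refine Finset.sum_congr rfl fun x _ => ?_
        rw [← Finset.sum_filter, Finset.sum_const, nsmul_eq_mul]
    _ ≤ ∑ x ∈ box₁ E H with x ≠ 0, c * (C * V / H * V ^ (d + 1)) := by
        refine Finset.sum_le_sum fun x hx => ?_
        rw [Finset.mem_filter] at hx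
        have := (hc H hH x hx.1 hx.2 (W.filter fun 𝔭 => x ∈ 𝔭.asIdeal) fun 𝔭 h𝔭 => by
          rw [Finset.mem_filter] at h𝔭
          refine ⟨?_, h𝔭.2⟩
          simpa using hW 𝔭 h𝔭.1).le
        gcongr
    _ ≤ V * (c * (C * V / H * V ^ (d + 1))) := by
        rw [Finset.sum_const, nsmul_eq_mul, ← hVc]
        gcongr
        exact Finset.filter_subset _ _
    _ = _ := by
        rw [boxSize_succ, Finset.prod_const, Finset.card_univ, Fintype.card_fin]
        ring

end Counting

/-! ### Box averages and the moments of the truncated count -/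

section Averages

open Filter Topology

variable {K : Type*} [Field K] [NumberField K] {ι : Type*} [Fintype ι] {d : ℕ}

/-- The average of `f` over the box, normalised by `boxSize`. -/
noncomputable def boxAverage (E : Module.Basis ι ℤ (𝓞 K)) {m : ℕ} (f : (Fin m → 𝓞 K) → ℝ) (H : ℕ) : ℝ :=
  (∑ A ∈ box E m H, f A) / boxSize K m H

theorem boxAverage_add (E : Module.Basis ι ℤ (𝓞 K)) {m : ℕ} (f g : (Fin m → 𝓞 K) → ℝ) (H : ℕ) :
    boxAverage E (fun A => f A + g A) H = boxAverage E f H + boxAverage E g H := by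
  simp only [boxAverage, Finset.sum_add_distrib, add_div]

theorem boxAverage_sub (E : Module.Basis ι ℤ (𝓞 K)) {m : ℕ} (f g : (Fin m → 𝓞 K) → ℝ) (H : ℕ) :
    boxAverage E (fun A => f A - g A) H = boxAverage E f H - boxAverage E g H := by
  simp only [boxAverage, Finset.sum_sub_distrib, sub_div]

theorem boxAverage_const_mul (E : Module.Basis ι ℤ (𝓞 K)) {m : ℕ} (c : ℝ) (f : (Fin m → 𝓞 K) → ℝ)
    (H : ℕ) : boxAverage E (fun A => c * f A) H = c * boxAverage E f H := by
  simp only [boxAverage, ← Finset.mul_sum, mul_div_assoc]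

theorem boxAverage_sum (E : Module.Basis ι ℤ (𝓞 K)) {m : ℕ} {α : Type*} (s : Finset α)
    (f : α → (Fin m → 𝓞 K) → ℝ) (H : ℕ) :
    boxAverage E (fun A => ∑ i ∈ s, f i A) H = ∑ i ∈ s, boxAverage E (f i) H := by
  simp only [boxAverage, ← Finset.sum_div]
  rw [Finset.sum_comm]

theorem boxAverage_mono (E : Module.Basis ι ℤ (𝓞 K)) {m : ℕ} {f g : (Fin m → 𝓞 K) → ℝ} {H : ℕ}
    (h : ∀ A ∈ box E m H, f A ≤ g A) : boxAverage E f H ≤ boxAverage E g H :=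
  div_le_div_of_nonneg_right (Finset.sum_le_sum h) (boxSize_nonneg m H)

theorem boxAverage_nonneg (E : Module.Basis ι ℤ (𝓞 K)) {m : ℕ} {f : (Fin m → 𝓞 K) → ℝ}
    (h : ∀ A, 0 ≤ f A) (H : ℕ) : 0 ≤ boxAverage E f H :=
  div_nonneg (Finset.sum_nonneg fun A _ => h A) (boxSize_nonneg m H)

theorem boxAverage_one (E : Module.Basis ι ℤ (𝓞 K)) (m : ℕ) {H : ℕ} (hH : 1 ≤ H) :
    boxAverage E (fun _ : Fin m → 𝓞 K => (1 : ℝ)) H = 1 := by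
  rw [boxAverage, Finset.sum_const, nsmul_eq_mul, mul_one, card_box,
    div_self (boxSize_pos m hH).ne']

theorem boxAverage_mul_sq_le (E : Module.Basis ι ℤ (𝓞 K)) {m : ℕ} (f g : (Fin m → 𝓞 K) → ℝ) (H : ℕ) :
    boxAverage E (fun A => f A * g A) H ^ 2 ≤
      boxAverage E (fun A => f A ^ 2) H * boxAverage E (fun A => g A ^ 2) H := by
  simp only [boxAverage]
  rw [div_pow, div_mul_div_comm, ← sq]
  exact div_le_div_of_nonneg_right (Finset.sum_mul_sq_le_sq_mul_sq _ _ _) (sq_nonneg _)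

open scoped Classical in
/-- The indicator function of the `𝔭`-Eisenstein polynomials. -/
noncomputable def eisensteinIndicator (𝔭 : HeightOneSpectrum (𝓞 K)) (A : Fin (d + 1) → 𝓞 K) : ℝ :=
  if IsEisensteinAt 𝔭 A then 1 else 0

/-- The number of primes for which a polynomial is Eisenstein. -/
noncomputable def eisensteinCount (A : Fin (d + 1) → 𝓞 K) : ℕ :=
  {𝔭 : HeightOneSpectrum (𝓞 K) | IsEisensteinAt 𝔭 A}.ncard

theorem eisensteinIndicator_nonneg (𝔭 : HeightOneSpectrum (𝓞 K)) (A : Fin (d + 1) → 𝓞 K) :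
    0 ≤ eisensteinIndicator 𝔭 A := by
  unfold eisensteinIndicator
  split_ifs <;> norm_num

open scoped Classical in
theorem sum_eisensteinIndicator (S : Finset (HeightOneSpectrum (𝓞 K))) (A : Fin (d + 1) → 𝓞 K) :
    ∑ 𝔭 ∈ S, eisensteinIndicator 𝔭 A = ((S.filter fun 𝔭 => IsEisensteinAt 𝔭 A).card : ℝ) := by
  simp only [eisensteinIndicator, Finset.sum_boole]

open scoped Classical in
theorem prod_eisensteinIndicator (S : Finset (HeightOneSpectrum (𝓞 K))) (A : Fin (d + 1) → 𝓞 K) :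
    ∏ 𝔭 ∈ S, eisensteinIndicator 𝔭 A = if ∀ 𝔭 ∈ S, IsEisensteinAt 𝔭 A then (1 : ℝ) else 0 := by
  simp only [eisensteinIndicator, Finset.prod_boole]

theorem sum_eisensteinIndicator_eq_count (S : Finset (HeightOneSpectrum (𝓞 K)))
    (A : Fin (d + 1) → 𝓞 K) (h : ∀ 𝔭, IsEisensteinAt 𝔭 A → 𝔭 ∈ S) :
    ∑ 𝔭 ∈ S, eisensteinIndicator 𝔭 A = eisensteinCount A := by
  classical
  rw [sum_eisensteinIndicator, eisensteinCount, ← Set.ncard_coe_finset]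
  congr 2
  ext 𝔭
  simp only [Finset.coe_filter, Set.mem_ofPred_eq]
  exact ⟨fun h => h.2, fun h' => ⟨h 𝔭 h', h'⟩⟩

theorem sum_eisensteinIndicator_le_count (hd : d ≠ 0) (S : Finset (HeightOneSpectrum (𝓞 K)))
    (A : Fin (d + 1) → 𝓞 K) : ∑ 𝔭 ∈ S, eisensteinIndicator 𝔭 A ≤ eisensteinCount A := by
  classical
  rw [← sum_eisensteinIndicator_eq_count (S ∪ (finite_eisensteinAt hd A).toFinset) A
    fun 𝔭 h => by simp [h]]
  exact Finset.sum_le_sum_of_subset_of_nonneg Finset.subset_union_left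
    fun _ _ _ => eisensteinIndicator_nonneg _ _

theorem count_sub_sum_eisensteinIndicator (hd : d ≠ 0) (S : Finset (HeightOneSpectrum (𝓞 K)))
    (A : Fin (d + 1) → 𝓞 K) :
    (eisensteinCount A : ℝ) - ∑ 𝔭 ∈ S, eisensteinIndicator 𝔭 A =
      {𝔭 : HeightOneSpectrum (𝓞 K) | 𝔭 ∉ S ∧ IsEisensteinAt 𝔭 A}.ncard := by
  classical
  set T := S ∪ (finite_eisensteinAt hd A).toFinset
  rw [← sum_eisensteinIndicator_eq_count T A fun 𝔭 h => by simp [T, h],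
    ← Finset.sum_sdiff (Finset.subset_union_left : S ⊆ T), add_sub_cancel_right,
    sum_eisensteinIndicator, ← Set.ncard_coe_finset]
  congr 2
  ext 𝔭
  simp only [Finset.coe_filter, Set.mem_ofPred_eq, Finset.mem_sdiff, Finset.mem_union,
    Set.Finite.mem_toFinset]
  tauto

open scoped Classical in
theorem boxAverage_prod_eisensteinIndicator (E : Module.Basis ι ℤ (𝓞 K))
    (S : Finset (HeightOneSpectrum (𝓞 K))) (H : ℕ) :
    boxAverage E (fun A : Fin (d + 1) → 𝓞 K => ∏ 𝔭 ∈ S, eisensteinIndicator 𝔭 A) H =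
      (((box E (d + 1) H).filter fun A => ∀ 𝔭 ∈ S, IsEisensteinAt 𝔭 A).card : ℝ) /
        boxSize K (d + 1) H := by
  simp only [boxAverage, prod_eisensteinIndicator, Finset.sum_boole]

theorem tendsto_boxAverage_prod_eisensteinIndicator (E : Module.Basis ι ℤ (𝓞 K)) (hd : 2 ≤ d)
    (S : Finset (HeightOneSpectrum (𝓞 K))) :
    Tendsto (boxAverage E fun A : Fin (d + 1) → 𝓞 K => ∏ 𝔭 ∈ S, eisensteinIndicator 𝔭 A) atTop
      (𝓝 (∏ 𝔭 ∈ S, eisensteinWeight d 𝔭)) := by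
  classical
  exact (tendsto_card_box_eisenstein E hd S).congr fun H =>
    (boxAverage_prod_eisensteinIndicator E S H).symm

theorem boxAverage_prod_eisensteinIndicator_le (E : Module.Basis ι ℤ (𝓞 K)) (hd : d ≠ 0)
    (S : Finset (HeightOneSpectrum (𝓞 K))) (hne : S.Nonempty) {H : ℕ} (hH : 1 ≤ H)
    (hS : ∏ 𝔭 ∈ S, primeBelow 𝔭 ≤ H) :
    boxAverage E (fun A : Fin (d + 1) → 𝓞 K => ∏ 𝔭 ∈ S, eisensteinIndicator 𝔭 A) H ≤
      ∏ 𝔭 ∈ S, majorant d 𝔭 := by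
  classical
  rw [boxAverage_prod_eisensteinIndicator, div_le_iff₀ (boxSize_pos _ hH), mul_comm]
  exact card_box_eisenstein_le E hd S hne H hS

/-- The primes above rational primes of size at most `H ^ (1 / n)`. -/
noncomputable def smallPrimes (K : Type*) [Field K] [NumberField K] (n H : ℕ) :
    Finset (HeightOneSpectrum (𝓞 K)) :=
  (finite_primeBelow_le (K := K) ((H : ℝ) ^ (1 / n : ℝ))).toFinset

theorem mem_smallPrimes {n H : ℕ} {𝔭 : HeightOneSpectrum (𝓞 K)} :
    𝔭 ∈ smallPrimes K n H ↔ (primeBelow 𝔭 : ℝ) ≤ (H : ℝ) ^ (1 / n : ℝ) := by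
  simp [smallPrimes]

theorem eventually_mem_smallPrimes {n : ℕ} (hn : 1 ≤ n) (𝔭 : HeightOneSpectrum (𝓞 K)) :
    ∀ᶠ H in atTop, 𝔭 ∈ smallPrimes K n H := by
  have hn' : (0 : ℝ) < n := by exact_mod_cast hn
  have h := (tendsto_rpow_atTop (one_div_pos.2 hn')).comp (tendsto_natCast_atTop_atTop (R := ℝ))
  filter_upwards [h.eventually_ge_atTop (primeBelow 𝔭 : ℝ)] with H hH
  exact mem_smallPrimes.2 hH

/-- The reason for truncating at `H ^ (1 / n)`: products of up to `n` truncated primes meet the size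
condition of `card_box_eisenstein_le`. -/
theorem prod_primeBelow_le {n H : ℕ} (hn : 1 ≤ n) (hH : 1 ≤ H)
    (S : Finset (HeightOneSpectrum (𝓞 K))) (hc : S.card ≤ n)
    (hS : ∀ 𝔭 ∈ S, (primeBelow 𝔭 : ℝ) ≤ (H : ℝ) ^ (1 / n : ℝ)) : ∏ 𝔭 ∈ S, primeBelow 𝔭 ≤ H := by
  have hH' : (1 : ℝ) ≤ H := by exact_mod_cast hH
  have hn' : (n : ℝ) ≠ 0 := by positivity
  have : (∏ 𝔭 ∈ S, (primeBelow 𝔭 : ℝ)) ≤ H := by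
    calc _ ≤ ∏ _𝔭 ∈ S, (H : ℝ) ^ (1 / n : ℝ) := Finset.prod_le_prod (fun _ _ => by positivity) hS
      _ = ((H : ℝ) ^ (1 / n : ℝ)) ^ S.card := Finset.prod_const _
      _ ≤ ((H : ℝ) ^ (1 / n : ℝ)) ^ n :=
          pow_le_pow_right₀ (Real.one_le_rpow hH' (by positivity)) hc
      _ = H := by
          rw [← Real.rpow_natCast _ n, ← Real.rpow_mul (by positivity), one_div_mul_cancel hn',
            Real.rpow_one]
  exact_mod_cast this

theorem eisensteinWeight_nonneg (𝔭 : HeightOneSpectrum (𝓞 K)) : 0 ≤ eisensteinWeight d 𝔭 := by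
  unfold eisensteinWeight
  positivity

theorem eisensteinWeight_pos (𝔭 : HeightOneSpectrum (𝓞 K)) : 0 < eisensteinWeight d 𝔭 := by
  have h : (2 : ℝ) ≤ Ideal.absNorm 𝔭.asIdeal := by exact_mod_cast two_le_absNorm 𝔭
  unfold eisensteinWeight
  have : (0 : ℝ) < (Ideal.absNorm 𝔭.asIdeal : ℝ) - 1 := by linarith
  positivity

theorem eisensteinWeight_le_inv_pow (𝔭 : HeightOneSpectrum (𝓞 K)) :
    eisensteinWeight d 𝔭 ≤ ((Ideal.absNorm 𝔭.asIdeal : ℝ) ^ d)⁻¹ := by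
  have h : (2 : ℝ) ≤ Ideal.absNorm 𝔭.asIdeal := by exact_mod_cast two_le_absNorm 𝔭
  have h0 : (0 : ℝ) < Ideal.absNorm 𝔭.asIdeal := by linarith
  unfold eisensteinWeight
  rw [div_le_iff₀ (by positivity), pow_add, inv_mul_cancel_left₀ (by positivity)]
  gcongr
  · linarith
  · linarith

theorem eisensteinWeight_lt_one (hd : d ≠ 0) (𝔭 : HeightOneSpectrum (𝓞 K)) :
    eisensteinWeight d 𝔭 < 1 := by
  have h : (2 : ℝ) ≤ Ideal.absNorm 𝔭.asIdeal := by exact_mod_cast two_le_absNorm 𝔭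
  exact (eisensteinWeight_le_inv_pow 𝔭).trans_lt (inv_lt_one_of_one_lt₀ (one_lt_pow₀ (by linarith) hd))

theorem summable_eisensteinWeight (hd : 2 ≤ d) :
    Summable fun 𝔭 : HeightOneSpectrum (𝓞 K) => eisensteinWeight d 𝔭 :=
  (summable_absNorm_inv_pow hd).of_nonneg_of_le eisensteinWeight_nonneg eisensteinWeight_le_inv_pow

theorem summable_eisensteinWeight_sq (hd : 2 ≤ d) :
    Summable fun 𝔭 : HeightOneSpectrum (𝓞 K) => eisensteinWeight d 𝔭 ^ 2 :=
  (summable_eisensteinWeight hd).of_nonneg_of_le (fun _ => sq_nonneg _) fun 𝔭 => by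
    rw [sq]
    exact mul_le_of_le_one_left (eisensteinWeight_nonneg 𝔭) (eisensteinWeight_lt_one (by omega) 𝔭).le

theorem multipliable_one_sub_eisensteinWeight (hd : 2 ≤ d) :
    Multipliable fun 𝔭 : HeightOneSpectrum (𝓞 K) => 1 - eisensteinWeight d 𝔭 := by
  simp only [sub_eq_add_neg]
  exact multipliable_one_add_of_summable (by simpa using (summable_eisensteinWeight hd).norm)

/-- All factors are at most `1`, so every partial product containing a chosen `𝔭` is at most `1 -
eisensteinWeight d 𝔭`. -/
theorem tprod_one_sub_eisensteinWeight_lt_one (hd : 2 ≤ d) :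
    ∏' 𝔭 : HeightOneSpectrum (𝓞 K), (1 - eisensteinWeight d 𝔭) < 1 := by
  classical
  obtain ⟨𝔭⟩ := exists_prime K
  refine lt_of_le_of_lt ?_ (sub_lt_self 1 (eisensteinWeight_pos (d := d) 𝔭))
  refine le_of_tendsto (multipliable_one_sub_eisensteinWeight hd).hasProd ?_
  filter_upwards [eventually_ge_atTop {𝔭}] with S hS
  rw [← Finset.prod_sdiff hS, Finset.prod_singleton]
  refine mul_le_of_le_one_left (sub_nonneg.2 (eisensteinWeight_lt_one (by omega) 𝔭).le) ?_
  exact Finset.prod_le_one (fun 𝔮 _ => sub_nonneg.2 (eisensteinWeight_lt_one (by omega) 𝔮).le)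
    fun 𝔮 _ => sub_le_self _ (eisensteinWeight_nonneg 𝔮)

/-- Dominated convergence for sums over all primes: a fixed prime eventually enters the truncation,
and `majorant` dominates the terms. -/
theorem tendsto_boxAverage_truncated (E : Module.Basis ι ℤ (𝓞 K)) (hd : 2 ≤ d) {n : ℕ} (hn : 1 ≤ n) :
    Tendsto (fun H => boxAverage E
      (fun A : Fin (d + 1) → 𝓞 K => ∑ 𝔭 ∈ smallPrimes K n H, eisensteinIndicator 𝔭 A) H) atTop
      (𝓝 (∑' 𝔭 : HeightOneSpectrum (𝓞 K), eisensteinWeight d 𝔭)) := by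
  classical
  have h1 : ∀ 𝔭 : HeightOneSpectrum (𝓞 K), Tendsto (fun H => if 𝔭 ∈ smallPrimes K n H then
      boxAverage E (fun A : Fin (d + 1) → 𝓞 K => eisensteinIndicator 𝔭 A) H else 0) atTop
      (𝓝 (eisensteinWeight d 𝔭)) := by
    intro 𝔭
    have := tendsto_boxAverage_prod_eisensteinIndicator E hd {𝔭}
    simp only [Finset.prod_singleton] at this
    refine this.congr' ?_
    filter_upwards [eventually_mem_smallPrimes hn 𝔭] with H hH
    rw [if_pos hH]
  have h2 := tendsto_tsum_of_dominated_convergence (summable_majorant (K := K) hd) h1 ?_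
  · refine h2.congr fun H => ?_
    rw [boxAverage_sum, tsum_eq_sum (s := smallPrimes K n H) (fun 𝔭 h => if_neg h)]
    exact Finset.sum_congr rfl fun 𝔭 h => if_pos h
  · filter_upwards [eventually_ge_atTop 1] with H hH 𝔭
    split_ifs with h
    · rw [Real.norm_of_nonneg (boxAverage_nonneg E (fun A => eisensteinIndicator_nonneg 𝔭 A) H)]
      have := boxAverage_prod_eisensteinIndicator_le (d := d) E (by omega) {𝔭} (by simp) hH
        (prod_primeBelow_le hn hH {𝔭} (by simpa using hn) (by simpa using mem_smallPrimes.1 h))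
      simpa using this
    · simpa using majorant_nonneg 𝔭

theorem summable_diagonal {α : Type*} [DecidableEq α] {f : α → ℝ} (hf : Summable f) :
    Summable fun z : α × α => if z.1 = z.2 then f z.1 else 0 := by
  have hinj : Function.Injective fun a : α => (a, a) := fun a b h => (Prod.ext_iff.1 h).1
  refine (hinj.summable_iff ?_).1 ?_
  · rintro ⟨a, b⟩ hab
    refine if_neg fun h => hab ⟨a, ?_⟩
    exact Prod.ext rfl h
  · simpa [Function.comp_def] using hf

theorem tsum_diagonal {α : Type*} [DecidableEq α] (f : α → ℝ) :
    ∑' z : α × α, (if z.1 = z.2 then f z.1 else 0) = ∑' a, f a := by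
  have hinj : Function.Injective fun a : α => (a, a) := fun a b h => (Prod.ext_iff.1 h).1
  rw [← hinj.tsum_eq]
  · simp
  · rintro ⟨a, b⟩ hab
    by_contra h
    refine hab (if_neg fun h' => h ⟨a, Prod.ext rfl h'⟩)

/-- The square is a sum over ordered pairs. Off the diagonal a pair contributes the product of two
weights; on it the indicator is idempotent, so the contribution is the weight and not its square.
This accounts for the correction by the sums of weights and of their squares. -/
theorem tendsto_boxAverage_truncated_sq (E : Module.Basis ι ℤ (𝓞 K)) (hd : 2 ≤ d) :
    Tendsto (fun H => boxAverage E
      (fun A : Fin (d + 1) → 𝓞 K => (∑ 𝔭 ∈ smallPrimes K 2 H, eisensteinIndicator 𝔭 A) ^ 2) H) atTop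
      (𝓝 ((∑' 𝔭 : HeightOneSpectrum (𝓞 K), eisensteinWeight d 𝔭) ^ 2 -
        ∑' 𝔭 : HeightOneSpectrum (𝓞 K), eisensteinWeight d 𝔭 ^ 2 +
        ∑' 𝔭 : HeightOneSpectrum (𝓞 K), eisensteinWeight d 𝔭)) := by
  classical
  have hmul : ∀ (𝔭 𝔮 : HeightOneSpectrum (𝓞 K)) (A : Fin (d + 1) → 𝓞 K),
      eisensteinIndicator 𝔭 A * eisensteinIndicator 𝔮 A =
        ∏ 𝔯 ∈ ({𝔭, 𝔮} : Finset (HeightOneSpectrum (𝓞 K))), eisensteinIndicator 𝔯 A := by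
    intro 𝔭 𝔮 A
    by_cases h : 𝔭 = 𝔮
    · subst h
      simp [eisensteinIndicator]
    · rw [Finset.prod_pair h]
  set g : HeightOneSpectrum (𝓞 K) × HeightOneSpectrum (𝓞 K) → ℝ := fun z =>
    eisensteinWeight d z.1 * eisensteinWeight d z.2 +
      if z.1 = z.2 then eisensteinWeight d z.1 - eisensteinWeight d z.1 ^ 2 else 0 with hg
  have hgS : ∀ z, g z = ∏ 𝔯 ∈ ({z.1, z.2} : Finset (HeightOneSpectrum (𝓞 K))), eisensteinWeight d 𝔯 := by
    rintro ⟨𝔭, 𝔮⟩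
    by_cases h : 𝔭 = 𝔮
    · subst h
      simp [hg]
      ring
    · rw [Finset.prod_pair h]
      simp [hg, h]
  -- The second summand is needed because a diagonal pair is bounded only by a single `majorant`.
  have hmaj : Summable fun z : HeightOneSpectrum (𝓞 K) × HeightOneSpectrum (𝓞 K) =>
      majorant d z.1 * majorant d z.2 + if z.1 = z.2 then majorant d z.1 else 0 :=
    ((summable_majorant hd).mul_of_nonneg (summable_majorant hd) (fun 𝔭 => majorant_nonneg 𝔭)
      (fun 𝔭 => majorant_nonneg 𝔭)).add (summable_diagonal (summable_majorant hd))
  have h1 : ∀ z : HeightOneSpectrum (𝓞 K) × HeightOneSpectrum (𝓞 K),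
      Tendsto (fun H => if z ∈ smallPrimes K 2 H ×ˢ smallPrimes K 2 H then
        boxAverage E (fun A : Fin (d + 1) → 𝓞 K =>
          eisensteinIndicator z.1 A * eisensteinIndicator z.2 A) H else 0) atTop (𝓝 (g z)) := by
    intro z
    have := tendsto_boxAverage_prod_eisensteinIndicator E hd {z.1, z.2}
    rw [← hgS] at this
    refine this.congr' ?_
    filter_upwards [eventually_mem_smallPrimes one_le_two z.1,
      eventually_mem_smallPrimes one_le_two z.2] with H hH1 hH2
    rw [if_pos (Finset.mem_product.2 ⟨hH1, hH2⟩)]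
    simp only [hmul]
  have h2 := tendsto_tsum_of_dominated_convergence hmaj h1 ?_
  · have hs := summable_eisensteinWeight (K := K) hd
    have hs2 := summable_eisensteinWeight_sq (K := K) hd
    have h3 : ∑' z, g z = (∑' 𝔭 : HeightOneSpectrum (𝓞 K), eisensteinWeight d 𝔭) ^ 2 -
        ∑' 𝔭 : HeightOneSpectrum (𝓞 K), eisensteinWeight d 𝔭 ^ 2 +
        ∑' 𝔭 : HeightOneSpectrum (𝓞 K), eisensteinWeight d 𝔭 := by
      have hp := hs.mul_of_nonneg hs (fun 𝔭 => eisensteinWeight_nonneg 𝔭)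
        (fun 𝔭 => eisensteinWeight_nonneg 𝔭)
      rw [hg, hp.tsum_add (summable_diagonal (hs.sub hs2)),
        tsum_diagonal fun 𝔭 => eisensteinWeight d 𝔭 - eisensteinWeight d 𝔭 ^ 2,
        hs.tsum_sub hs2, ← hs.tsum_mul_tsum hs hp]
      ring
    rw [h3] at h2
    refine h2.congr fun H => ?_
    rw [tsum_eq_sum (s := smallPrimes K 2 H ×ˢ smallPrimes K 2 H) (fun z h => if_neg h),
      Finset.sum_congr rfl fun z h => if_pos h, ← boxAverage_sum]
    congr 1
    funext A
    rw [sq, Finset.sum_mul_sum, Finset.sum_product]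
  · filter_upwards [eventually_ge_atTop 1] with H hH z
    have hb : 0 ≤ majorant d z.1 * majorant d z.2 + if z.1 = z.2 then majorant d z.1 else 0 := by
      have := mul_nonneg (majorant_nonneg (d := d) z.1) (majorant_nonneg (d := d) z.2)
      have := majorant_nonneg (d := d) z.1
      split_ifs <;> positivity
    by_cases h : z ∈ smallPrimes K 2 H ×ˢ smallPrimes K 2 H
    · rw [if_pos h]
      rw [Finset.mem_product] at h
      rw [Real.norm_of_nonneg (boxAverage_nonneg E (fun A => mul_nonneg
        (eisensteinIndicator_nonneg _ A) (eisensteinIndicator_nonneg _ A)) H)]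
      simp only [hmul]
      refine (boxAverage_prod_eisensteinIndicator_le (d := d) E (by omega) {z.1, z.2} (by simp) hH
        (prod_primeBelow_le one_le_two hH {z.1, z.2} Finset.card_le_two ?_)).trans ?_
      · intro 𝔭 h𝔭
        rw [Finset.mem_insert, Finset.mem_singleton] at h𝔭
        rcases h𝔭 with rfl | rfl
        exacts [mem_smallPrimes.1 h.1, mem_smallPrimes.1 h.2]
      · by_cases he : z.1 = z.2
        · rw [he]
          have := mul_self_nonneg (majorant d z.2)
          simpa using this
        · rw [Finset.prod_pair he, if_neg he, add_zero]
    · rw [if_neg h, norm_zero]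
      exact hb

end Averages

/-! ### Removal of the truncation: moments, density and the tail condition -/

section Moments

open Filter Topology

variable {K : Type*} [Field K] [NumberField K] {ι : Type*} [Fintype ι] {d : ℕ}

/-- The number of primes for which a polynomial is Eisenstein and that lie above rational primes
larger than `H ^ (1 / n)`. -/
noncomputable def largeCount (n H : ℕ) (A : Fin (d + 1) → 𝓞 K) : ℝ :=
  eisensteinCount A - ∑ 𝔭 ∈ smallPrimes K n H, eisensteinIndicator 𝔭 A

theorem largeCount_nonneg (hd : d ≠ 0) (n H : ℕ) (A : Fin (d + 1) → 𝓞 K) : 0 ≤ largeCount n H A :=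
  sub_nonneg.2 (sum_eisensteinIndicator_le_count hd _ A)

theorem exists_ncard_large_eisenstein_lt (E : Module.Basis ι ℤ (𝓞 K)) (hd : d ≠ 0) {n : ℕ}
    (hn : 1 ≤ n) : ∃ c : ℕ, ∀ H : ℕ, 1 ≤ H → ∀ A ∈ box E (d + 1) H,
      {𝔭 : HeightOneSpectrum (𝓞 K) |
        (H : ℝ) ^ (1 / n : ℝ) < primeBelow 𝔭 ∧ IsEisensteinAt 𝔭 A}.ncard < c := by
  obtain ⟨c, hc⟩ := exists_card_large_primes_lt E hn
  refine ⟨c + 1, fun H hH A hA => ?_⟩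
  have hfin : {𝔭 : HeightOneSpectrum (𝓞 K) |
      (H : ℝ) ^ (1 / n : ℝ) < primeBelow 𝔭 ∧ IsEisensteinAt 𝔭 A}.Finite :=
    (finite_eisensteinAt hd A).subset fun 𝔭 h => h.2
  by_cases h0 : A 0 = 0
  · have : {𝔭 : HeightOneSpectrum (𝓞 K) |
        (H : ℝ) ^ (1 / n : ℝ) < primeBelow 𝔭 ∧ IsEisensteinAt 𝔭 A} = ∅ :=
      Set.eq_empty_of_forall_notMem fun 𝔭 h => h.2.zero_ne_zero h0
    rw [this, Set.ncard_empty]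
    omega
  · rw [Set.ncard_eq_toFinset_card _ hfin]
    refine Nat.lt_succ_of_lt (hc H hH (A 0) (Fintype.mem_piFinset.1 hA 0) h0 _ fun 𝔭 h => ?_)
    rw [Set.Finite.mem_toFinset] at h
    exact ⟨h.1, h.2.zero_mem hd⟩

theorem exists_largeCount_le (E : Module.Basis ι ℤ (𝓞 K)) (hd : d ≠ 0) {n : ℕ} (hn : 1 ≤ n) :
    ∃ c : ℝ, 0 ≤ c ∧ ∀ H : ℕ, 1 ≤ H → ∀ A ∈ box E (d + 1) H, largeCount n H A ≤ c := by
  obtain ⟨c, hc⟩ := exists_ncard_large_eisenstein_lt (d := d) E hd hn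
  refine ⟨c, Nat.cast_nonneg c, fun H hH A hA => ?_⟩
  rw [largeCount, count_sub_sum_eisensteinIndicator hd]
  simp only [mem_smallPrimes, not_le]
  exact_mod_cast (hc H hH A hA).le

/-- For `n = 1` the omitted primes all lie above rational primes exceeding `H`, where
`exists_sum_card_large_primes_le` applies. -/
theorem tendsto_boxAverage_largeCount_one (E : Module.Basis ι ℤ (𝓞 K)) (hd : 2 ≤ d) :
    Tendsto (fun H => boxAverage E (fun A : Fin (d + 1) → 𝓞 K => largeCount 1 H A) H) atTop (𝓝 0) := by
  classical
  obtain ⟨C, hC0, hC⟩ := exists_sum_card_large_primes_le (d := d) E hd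
  refine squeeze_zero' (Eventually.of_forall fun H =>
    boxAverage_nonneg E (largeCount_nonneg (by omega) 1 H) H) ?_ (tendsto_const_div_atTop_nhds_zero_nat C)
  filter_upwards [eventually_ge_atTop 1] with H hH
  -- Only finitely many primes matter for a given box, so the omitted primes may be replaced by a
  -- finite set.
  set V := (box E (d + 1) H).biUnion fun A => (finite_eisensteinAt (by omega : d ≠ 0) A).toFinset
  set W := V \ smallPrimes K 1 H with hW
  have h1 : ∀ A ∈ box E (d + 1) H, largeCount 1 H A ≤ ∑ 𝔭 ∈ W, eisensteinIndicator 𝔭 A := by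
    intro A hA
    rw [largeCount, ← sum_eisensteinIndicator_eq_count (smallPrimes K 1 H ∪ V) A,
      ← Finset.union_sdiff_self_eq_union, Finset.sum_union Finset.disjoint_sdiff, add_sub_cancel_left]
    intro 𝔭 h𝔭
    refine Finset.mem_union_right _ (Finset.mem_biUnion.2 ⟨A, hA, ?_⟩)
    simpa using h𝔭
  refine (boxAverage_mono E h1).trans ?_
  rw [boxAverage_sum]
  have h2 := hC H hH W fun 𝔭 h𝔭 => by
    have h := (Finset.mem_sdiff.1 h𝔭).2
    rw [mem_smallPrimes] at h
    simpa using h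
  have h3 : ∀ 𝔭 : HeightOneSpectrum (𝓞 K), boxAverage E (fun A : Fin (d + 1) → 𝓞 K =>
      eisensteinIndicator 𝔭 A) H =
        (((box E (d + 1) H).filter fun A => IsEisensteinAt 𝔭 A).card : ℝ) / boxSize K (d + 1) H := by
    intro 𝔭
    simp only [boxAverage, eisensteinIndicator, Finset.sum_boole]
  simp only [h3]
  rw [← Finset.sum_div, div_le_iff₀ (boxSize_pos _ hH), mul_comm]
  exact h2

theorem tendsto_boxAverage_count (E : Module.Basis ι ℤ (𝓞 K)) (hd : 2 ≤ d) :
    Tendsto (boxAverage E fun A : Fin (d + 1) → 𝓞 K => (eisensteinCount A : ℝ)) atTop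
      (𝓝 (∑' 𝔭 : HeightOneSpectrum (𝓞 K), eisensteinWeight d 𝔭)) := by
  have h := (tendsto_boxAverage_truncated E hd le_rfl).add (tendsto_boxAverage_largeCount_one E hd)
  rw [add_zero] at h
  refine h.congr fun H => ?_
  rw [← boxAverage_add]
  simp only [largeCount, add_sub_cancel]

/-- The full and the truncated means have the same limit, so the range between `H ^ (1 / n)` and `H`
needs no estimate of its own. -/
theorem tendsto_boxAverage_largeCount (E : Module.Basis ι ℤ (𝓞 K)) (hd : 2 ≤ d) {n : ℕ} (hn : 1 ≤ n) :
    Tendsto (fun H => boxAverage E (fun A : Fin (d + 1) → 𝓞 K => largeCount n H A) H) atTop (𝓝 0) := by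
  have h := (tendsto_boxAverage_count E hd).sub (tendsto_boxAverage_truncated E hd hn)
  rw [sub_self] at h
  refine h.congr fun H => ?_
  rw [← boxAverage_sub]
  rfl

theorem tendsto_boxAverage_largeCount_sq (E : Module.Basis ι ℤ (𝓞 K)) (hd : 2 ≤ d) {n : ℕ}
    (hn : 1 ≤ n) : Tendsto (fun H => boxAverage E
      (fun A : Fin (d + 1) → 𝓞 K => largeCount n H A ^ 2) H) atTop (𝓝 0) := by
  obtain ⟨c, hc0, hc⟩ := exists_largeCount_le (d := d) E (by omega) hn
  have h := (tendsto_boxAverage_largeCount E hd hn).const_mul c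
  rw [mul_zero] at h
  refine squeeze_zero' (Eventually.of_forall fun H =>
    boxAverage_nonneg E (fun _ => sq_nonneg _) H) ?_ h
  filter_upwards [eventually_ge_atTop 1] with H hH
  rw [← boxAverage_const_mul]
  refine boxAverage_mono E fun A hA => ?_
  rw [sq]
  exact mul_le_mul_of_nonneg_right (hc H hH A hA) (largeCount_nonneg (by omega) n H A)

/-- Expand the square of truncated count plus remainder. The remainder tends to zero in mean square,
and by Cauchy-Schwarz so does the mean of the cross term. -/
theorem tendsto_boxAverage_count_sq (E : Module.Basis ι ℤ (𝓞 K)) (hd : 2 ≤ d) :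
    Tendsto (boxAverage E fun A : Fin (d + 1) → 𝓞 K => (eisensteinCount A : ℝ) ^ 2) atTop
      (𝓝 ((∑' 𝔭 : HeightOneSpectrum (𝓞 K), eisensteinWeight d 𝔭) ^ 2 -
        ∑' 𝔭 : HeightOneSpectrum (𝓞 K), eisensteinWeight d 𝔭 ^ 2 +
        ∑' 𝔭 : HeightOneSpectrum (𝓞 K), eisensteinWeight d 𝔭)) := by
  have hT := tendsto_boxAverage_truncated_sq E hd
  have hR := tendsto_boxAverage_largeCount_sq E hd one_le_two
  have hTR : Tendsto (fun H => boxAverage E (fun A : Fin (d + 1) → 𝓞 K =>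
      (∑ 𝔭 ∈ smallPrimes K 2 H, eisensteinIndicator 𝔭 A) * largeCount 2 H A) H) atTop (𝓝 0) := by
    have h0 := hT.mul hR
    rw [mul_zero] at h0
    have h1 := (Real.continuous_sqrt.tendsto 0).comp h0
    rw [Real.sqrt_zero] at h1
    refine squeeze_zero_norm (fun H => ?_) h1
    rw [Real.norm_eq_abs]
    exact Real.abs_le_sqrt (boxAverage_mul_sq_le E _ _ H)
  have h := (hT.add (hTR.const_mul 2)).add hR
  rw [mul_zero, add_zero, add_zero] at h
  refine h.congr fun H => ?_
  rw [← boxAverage_const_mul, ← boxAverage_add, ← boxAverage_add]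
  congr 1
  funext A
  simp only [largeCount]
  ring

open scoped Classical in
theorem tendsto_boxAverage_not_eisenstein (E : Module.Basis ι ℤ (𝓞 K)) (hd : 2 ≤ d) :
    Tendsto (boxAverage E fun A : Fin (d + 1) → 𝓞 K => if A ∈ eisensteinSet K d then (0 : ℝ) else 1)
      atTop (𝓝 (∏' 𝔭 : HeightOneSpectrum (𝓞 K), (1 - eisensteinWeight d 𝔭))) := by
  have hd0 : d ≠ 0 := by omega
  have hprod : ∀ S : Finset (HeightOneSpectrum (𝓞 K)), Tendsto (boxAverage E
      fun A : Fin (d + 1) → 𝓞 K => ∏ 𝔭 ∈ S, (1 - eisensteinIndicator 𝔭 A)) atTop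
      (𝓝 (∏ 𝔭 ∈ S, (1 - eisensteinWeight d 𝔭))) := by
    intro S
    have h := tendsto_finsetSum S.powerset fun T _ =>
      (tendsto_boxAverage_prod_eisensteinIndicator E hd T).const_mul ((-1) ^ T.card)
    have e : ∀ f : HeightOneSpectrum (𝓞 K) → ℝ,
        ∏ 𝔭 ∈ S, (1 - f 𝔭) = ∑ T ∈ S.powerset, (-1) ^ T.card * ∏ 𝔭 ∈ T, f 𝔭 := fun f => by
      simp only [sub_eq_add_neg]
      rw [Finset.prod_one_add]
      simp only [Finset.prod_neg]
    simp only [e]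
    refine h.congr fun H => ?_
    rw [boxAverage_sum]
    simp only [boxAverage_const_mul]
  -- Sieving by the finite set `S` errs only on tuples that are Eisenstein exclusively at primes
  -- outside `S`, and the count of such primes bounds the error.
  have hle : ∀ (S : Finset (HeightOneSpectrum (𝓞 K))) (A : Fin (d + 1) → 𝓞 K),
      (if A ∈ eisensteinSet K d then (0 : ℝ) else 1) ≤ ∏ 𝔭 ∈ S, (1 - eisensteinIndicator 𝔭 A) ∧
      ∏ 𝔭 ∈ S, (1 - eisensteinIndicator 𝔭 A) ≤ (if A ∈ eisensteinSet K d then (0 : ℝ) else 1) +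
        (eisensteinCount A - ∑ 𝔭 ∈ S, eisensteinIndicator 𝔭 A) := by
    intro S A
    have hc := sum_eisensteinIndicator_le_count hd0 S A
    by_cases hA : A ∈ eisensteinSet K d
    · rw [if_pos hA, zero_add]
      by_cases hS : ∃ 𝔭 ∈ S, IsEisensteinAt 𝔭 A
      · obtain ⟨𝔭, h𝔭, hE⟩ := hS
        rw [Finset.prod_eq_zero h𝔭 (by simp [eisensteinIndicator, hE])]
        exact ⟨le_rfl, sub_nonneg.2 hc⟩
      · push Not at hS
        have h0 : ∀ 𝔭 ∈ S, eisensteinIndicator 𝔭 A = 0 := fun 𝔭 h => if_neg (hS 𝔭 h)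
        rw [Finset.sum_eq_zero h0, Finset.prod_eq_one fun 𝔭 h => by rw [h0 𝔭 h, sub_zero]]
        obtain ⟨𝔭, h𝔭⟩ := hA
        have h1 := sum_eisensteinIndicator_le_count hd0 {𝔭} A
        rw [Finset.sum_singleton, eisensteinIndicator, if_pos h𝔭] at h1
        exact ⟨zero_le_one, by linarith⟩
    · rw [if_neg hA]
      have h0 : ∀ 𝔭 ∈ S, eisensteinIndicator 𝔭 A = 0 := fun 𝔭 _ => if_neg fun h => hA ⟨𝔭, h⟩
      rw [Finset.prod_eq_one fun 𝔭 h => by rw [h0 𝔭 h, sub_zero]]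
      exact ⟨le_rfl, by linarith⟩
  have hs := summable_eisensteinWeight (K := K) hd
  rw [Metric.tendsto_nhds]
  intro ε hε
  -- One `S` serves both for the partial product and for the tail of the sum; with the two limits in
  -- `H` this makes four errors of `ε / 4`.
  obtain ⟨S, hS1, hS2⟩ := (((multipliable_one_sub_eisensteinWeight (K := K) hd).hasProd.eventually
    (Metric.ball_mem_nhds _ (by positivity : 0 < ε / 4))).and
      (hs.hasSum.eventually (Metric.ball_mem_nhds _ (by positivity : 0 < ε / 4)))).exists
  have hsum := tendsto_finsetSum S fun 𝔭 _ => tendsto_boxAverage_prod_eisensteinIndicator (d := d) E hd {𝔭}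
  simp only [Finset.prod_singleton] at hsum
  filter_upwards [(hprod S).eventually (Metric.ball_mem_nhds _ (by positivity : 0 < ε / 4)),
    ((tendsto_boxAverage_count E hd).sub hsum).eventually
      (Metric.ball_mem_nhds _ (by positivity : 0 < ε / 4))] with H h1 h2
  have h3 := boxAverage_mono E (H := H) fun A (_ : A ∈ box E (d + 1) H) => (hle S A).1
  have h4 := boxAverage_mono E (H := H) fun A (_ : A ∈ box E (d + 1) H) => (hle S A).2
  rw [boxAverage_add, boxAverage_sub, boxAverage_sum] at h4
  simp only [Real.dist_eq, abs_lt] at hS1 hS2 h1 h2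
  rw [Real.dist_eq, abs_lt]
  constructor <;> linarith [hS1.1, hS1.2, hS2.1, hS2.2, h1.1, h1.2, h2.1, h2.2]

theorem hasDensity_eisensteinSet (E : Module.Basis ι ℤ (𝓞 K)) (hd : 2 ≤ d) :
    HasDensity E (eisensteinSet K d) (1 - ∏' 𝔭 : HeightOneSpectrum (𝓞 K), (1 - eisensteinWeight d 𝔭)) := by
  classical
  refine (tendsto_const_nhds.sub (tendsto_boxAverage_not_eisenstein E hd)).congr' ?_
  filter_upwards [eventually_ge_atTop 1] with H hH
  have h1 := boxAverage_sub E (fun _ : Fin (d + 1) → 𝓞 K => (1 : ℝ))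
    (fun A => if A ∈ eisensteinSet K d then (0 : ℝ) else 1) H
  rw [boxAverage_one E (d + 1) hH] at h1
  rw [← h1, boxAverage]
  congr 1
  have : (box E (d + 1) H : Set (Fin (d + 1) → 𝓞 K)) ∩ eisensteinSet K d =
      ((box E (d + 1) H).filter (· ∈ eisensteinSet K d) : Finset _) := by
    ext A; simp
  rw [this, Set.ncard_coe_finset, ← Finset.sum_boole]
  refine Finset.sum_congr rfl fun A _ => ?_
  split_ifs <;> norm_num

/-- By Markov's inequality the upper density is at most the limiting mean number of Eisenstein
primes with residue characteristic above `M`, which is a tail of a convergent series. -/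
theorem tendsto_upperDensity_large (E : Module.Basis ι ℤ (𝓞 K)) (hd : 2 ≤ d) :
    Tendsto (fun M : ℕ => upperDensity E {A : Fin (d + 1) → 𝓞 K | ∃ 𝔭 : HeightOneSpectrum (𝓞 K),
      M < primeBelow 𝔭 ∧ IsEisensteinAt 𝔭 A}) atTop (𝓝 0) := by
  classical
  have hd0 : d ≠ 0 := by omega
  set T : ℕ → Set (Fin (d + 1) → 𝓞 K) := fun M =>
    {A | ∃ 𝔭 : HeightOneSpectrum (𝓞 K), M < primeBelow 𝔭 ∧ IsEisensteinAt 𝔭 A} with hT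
  set W : ℕ → Finset (HeightOneSpectrum (𝓞 K)) := fun M => (finite_primeBelow_le (K := K) M).toFinset
  have hmem : ∀ M 𝔭, 𝔭 ∈ W M ↔ primeBelow 𝔭 ≤ M := fun M 𝔭 => by simp [W]
  have hs := summable_eisensteinWeight (K := K) hd
  have hW : Tendsto W atTop atTop := by
    refine tendsto_atTop_finset_of_monotone (fun a b hab 𝔭 h => ?_) fun 𝔭 => ⟨primeBelow 𝔭, ?_⟩
    · exact (hmem _ _).2 (((hmem _ _).1 h).trans hab)
    · exact (hmem _ _).2 le_rfl
  have hlim : Tendsto (fun M => ∑' 𝔭 : HeightOneSpectrum (𝓞 K), eisensteinWeight d 𝔭 -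
      ∑ 𝔭 ∈ W M, eisensteinWeight d 𝔭) atTop (𝓝 0) := by
    have := (tendsto_const_nhds (x := ∑' 𝔭 : HeightOneSpectrum (𝓞 K), eisensteinWeight d 𝔭)).sub
      (hs.hasSum.comp hW)
    rwa [sub_self] at this
  have hle : ∀ M H, (((box E (d + 1) H : Set (Fin (d + 1) → 𝓞 K)) ∩ T M).ncard : ℝ) /
      boxSize K (d + 1) H ≤ boxAverage E (fun A : Fin (d + 1) → 𝓞 K =>
        eisensteinCount A - ∑ 𝔭 ∈ W M, eisensteinIndicator 𝔭 A) H := by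
    intro M H
    have : (box E (d + 1) H : Set (Fin (d + 1) → 𝓞 K)) ∩ T M =
        ((box E (d + 1) H).filter (· ∈ T M) : Finset _) := by
      ext A; simp
    rw [this, Set.ncard_coe_finset, ← Finset.sum_boole]
    refine boxAverage_mono E fun A _ => ?_
    rw [count_sub_sum_eisensteinIndicator hd0]
    split_ifs with h
    · obtain ⟨𝔭, h1, h2⟩ := h
      have hfin : {𝔭 : HeightOneSpectrum (𝓞 K) | 𝔭 ∉ W M ∧ IsEisensteinAt 𝔭 A}.Finite :=
        (finite_eisensteinAt hd0 A).subset fun 𝔭 h => h.2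
      have : 0 < {𝔭 : HeightOneSpectrum (𝓞 K) | 𝔭 ∉ W M ∧ IsEisensteinAt 𝔭 A}.ncard :=
        (Set.ncard_pos hfin).2 ⟨𝔭, by rw [hmem]; omega, h2⟩
      exact_mod_cast this
    · positivity
  have havg : ∀ M, Tendsto (boxAverage E (fun A : Fin (d + 1) → 𝓞 K =>
        eisensteinCount A - ∑ 𝔭 ∈ W M, eisensteinIndicator 𝔭 A)) atTop
      (𝓝 (∑' 𝔭 : HeightOneSpectrum (𝓞 K), eisensteinWeight d 𝔭 - ∑ 𝔭 ∈ W M, eisensteinWeight d 𝔭)) := by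
    intro M
    have hsum := tendsto_finsetSum (W M) fun 𝔭 _ =>
      tendsto_boxAverage_prod_eisensteinIndicator (d := d) E hd {𝔭}
    simp only [Finset.prod_singleton] at hsum
    refine ((tendsto_boxAverage_count E hd).sub hsum).congr fun H => ?_
    rw [boxAverage_sub, boxAverage_sum]
  have h0 : ∀ M H, 0 ≤ (((box E (d + 1) H : Set (Fin (d + 1) → 𝓞 K)) ∩ T M).ncard : ℝ) /
      boxSize K (d + 1) H := fun M H => div_nonneg (Nat.cast_nonneg _) (boxSize_nonneg _ _)
  -- A real `limsup` is meaningful only for bounded functions, so both bounds are recorded before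
  -- comparing.
  have hbdd : ∀ M, IsBoundedUnder (· ≤ ·) atTop fun H : ℕ =>
      (((box E (d + 1) H : Set (Fin (d + 1) → 𝓞 K)) ∩ T M).ncard : ℝ) / boxSize K (d + 1) H := fun M =>
    (havg M).isBoundedUnder_le.mono_le (Eventually.of_forall (hle M))
  have hbdd' : ∀ M, IsBoundedUnder (· ≥ ·) atTop fun H : ℕ =>
      (((box E (d + 1) H : Set (Fin (d + 1) → 𝓞 K)) ∩ T M).ncard : ℝ) / boxSize K (d + 1) H := fun M =>
    ⟨0, eventually_map.2 (Eventually.of_forall (h0 M))⟩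
  refine squeeze_zero (fun M => ?_) (fun M => ?_) hlim
  · exact le_limsup_of_frequently_le (Eventually.of_forall (h0 M)).frequently (hbdd M)
  · rw [← (havg M).limsup_eq]
    exact limsup_le_limsup (Eventually.of_forall (hle M)) (hbdd' M).isCoboundedUnder_le
      (havg M).isBoundedUnder_le

end Moments

/-! ### The ideals `𝔭^j 𝔬_𝔭` -/

section LocalIdeals

open HeightOneSpectrum
open scoped Valued WithZero

variable {K : Type*} [Field K] [NumberField K]

theorem valued_algebraMap (𝔭 : HeightOneSpectrum (𝓞 K)) (a : 𝓞 K) :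
    Valued.v ((algebraMap (𝓞 K) (𝔭.adicCompletionIntegers K) a : 𝔭.adicCompletionIntegers K) :
      𝔭.adicCompletion K) = 𝔭.intValuation a := by
  change Valued.v ((algebraMap (𝓞 K) K a : K) : 𝔭.adicCompletion K) = _
  rw [valuedAdicCompletion_eq_valuation', valuation_of_algebraMap]

/-- The ultrametric inequality carries the valuation bound from the generators to the whole extended
ideal, and the valuation of `a` detects membership in `𝔭 ^ j`. -/
theorem algebraMap_mem_localIdeal_iff (𝔭 : HeightOneSpectrum (𝓞 K)) (j : ℕ) (a : 𝓞 K) :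
    algebraMap (𝓞 K) (𝔭.adicCompletionIntegers K) a ∈ localIdeal 𝔭 j ↔ a ∈ 𝔭.asIdeal ^ j := by
  refine ⟨fun h => ?_, Ideal.mem_map_of_mem _⟩
  rw [← intValuation_le_pow_iff_mem, ← valued_algebraMap]
  refine Submodule.span_induction (p := fun (x : 𝔭.adicCompletionIntegers K) _ =>
    Valued.v (x : 𝔭.adicCompletion K) ≤ WithZero.exp (-(j : ℤ))) ?_ ?_ ?_ ?_ h
  · rintro _ ⟨b, hb, rfl⟩
    rw [valued_algebraMap]
    exact (intValuation_le_pow_iff_mem 𝔭 b j).2 hb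
  · simp
  · intro x y _ _ hx hy
    exact (Valuation.map_add _ _ _).trans (max_le hx hy)
  · intro r x _ hx
    rw [smul_eq_mul]
    change Valued.v ((r : 𝔭.adicCompletion K) * (x : 𝔭.adicCompletion K)) ≤ _
    rw [map_mul]
    exact (mul_le_of_le_one_left' r.2).trans hx

/-- The ideal contains a nonzero `π`, hence every `x` with `π⁻¹ * x` integral, which includes a
neighbourhood of zero. An open subgroup is closed. -/
theorem isClopen_localIdeal (𝔭 : HeightOneSpectrum (𝓞 K)) (j : ℕ) :
    IsClopen (localIdeal 𝔭 j : Set (𝔭.adicCompletionIntegers K)) := by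
  obtain ⟨b, hb, hb0⟩ := Submodule.exists_mem_ne_zero_of_ne_bot (pow_ne_zero j 𝔭.ne_bot)
  set π : 𝔭.adicCompletionIntegers K := algebraMap (𝓞 K) (𝔭.adicCompletionIntegers K) b with hπ
  have hπ0 : (π : 𝔭.adicCompletion K) ≠ 0 := by
    rw [← Valuation.ne_zero_iff Valued.v, hπ, valued_algebraMap]
    exact intValuation_ne_zero 𝔭 b hb0
  have hopen : IsOpen (localIdeal 𝔭 j : Set (𝔭.adicCompletionIntegers K)) := by
    refine AddSubgroup.isOpen_of_mem_nhds (localIdeal 𝔭 j).toAddSubgroup (g := 0) ?_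
    have hU : IsOpen {x : 𝔭.adicCompletionIntegers K |
        Valued.v ((π : 𝔭.adicCompletion K)⁻¹ * (x : 𝔭.adicCompletion K)) < 1} := by
      have := (Valued.isOpen_ball (𝔭.adicCompletion K) 1).preimage
        (continuous_const.mul continuous_subtype_val :
          Continuous fun x : 𝔭.adicCompletionIntegers K =>
            (π : 𝔭.adicCompletion K)⁻¹ * (x : 𝔭.adicCompletion K))
      simpa [Set.preimage, Valuation.restrict_lt_one_iff] using this
    refine Filter.mem_of_superset (hU.mem_nhds (by simp)) fun x hx => ?_
    have hx' : x = ⟨(π : 𝔭.adicCompletion K)⁻¹ * (x : 𝔭.adicCompletion K), by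
        rw [mem_adicCompletionIntegers]; exact le_of_lt hx⟩ * π := by
      refine Subtype.ext ?_
      change (x : 𝔭.adicCompletion K) = (π : 𝔭.adicCompletion K)⁻¹ * x * π
      field_simp
    rw [hx']
    exact Ideal.mul_mem_left _ _ (Ideal.mem_map_of_mem _ hb)
  exact ⟨AddSubgroup.isClosed_of_isOpen (localIdeal 𝔭 j).toAddSubgroup hopen, hopen⟩

end LocalIdeals

/-! ### The Eisenstein system: hypotheses, mean and variance -/

section System

open Filter Topology

variable {K : Type*} [Field K] [NumberField K] {ι : Type*} [Fintype ι] {d : ℕ}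

theorem eisensteinSystem_mem_some (hd : d ≠ 0) (𝔭 : HeightOneSpectrum (𝓞 K))
    (A : Fin (d + 1) → 𝓞 K) : (eisensteinSystem K d).Mem A (some 𝔭) ↔ IsEisensteinAt 𝔭 A := by
  have h0 : (0 : Fin (d + 1)) ≠ Fin.last d := by
    rw [Ne, Fin.ext_iff]; simpa using hd.symm
  simp only [LocalSystem.Mem, eisensteinSystem, Set.mem_ofPred_eq, algebraMap_mem_localIdeal_iff,
    pow_one, IsEisensteinAt]
  constructor
  · rintro ⟨⟨h1, h2⟩, h3, h4⟩
    refine ⟨h4, h2, fun i hi => ?_⟩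
    by_cases hz : i = 0
    · exact hz ▸ h1
    · exact h3 i hz hi
  · rintro ⟨h1, h2, h3⟩
    exact ⟨⟨h3 0 h0, h2⟩, fun i _ hi => h3 i hi, h1⟩

theorem eisensteinSystem_places (hd : d ≠ 0) (A : Fin (d + 1) → 𝓞 K) :
    (eisensteinSystem K d).places A = some '' {𝔭 | IsEisensteinAt 𝔭 A} := by
  ext η
  cases η with
  | none => simp [LocalSystem.places, LocalSystem.Mem, eisensteinSystem]
  | some 𝔭 =>
    have := eisensteinSystem_mem_some hd 𝔭 A
    simpa [LocalSystem.places] using this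

theorem ncard_eisensteinSystem_places (hd : d ≠ 0) (A : Fin (d + 1) → 𝓞 K) :
    ((eisensteinSystem K d).places A).ncard = eisensteinCount A := by
  rw [eisensteinSystem_places hd, Set.ncard_image_of_injective _ (Option.some_injective _)]
  rfl

theorem eisensteinSystem_goodBox (hd : d ≠ 0) (E : Module.Basis ι ℤ (𝓞 K)) (H : ℕ) :
    (eisensteinSystem K d).goodBox E H = box E (d + 1) H := by
  classical
  rw [LocalSystem.goodBox, Finset.filter_eq_self]
  intro A _ hA
  rw [LocalSystem.exceptional, Set.mem_ofPred_eq, eisensteinSystem_places hd] at hA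
  exact hA ((finite_eisensteinAt hd A).image _)

theorem eisensteinSystem_tailCondition (hd : 2 ≤ d) (E : Module.Basis ι ℤ (𝓞 K)) :
    (eisensteinSystem K d).TailCondition E := by
  simp only [LocalSystem.TailCondition, eisensteinSystem_mem_some (by omega : d ≠ 0)]
  exact tendsto_upperDensity_large E hd

theorem eisensteinSystem_correspondsTo (hd : 2 ≤ d) (E : Module.Basis ι ℤ (𝓞 K)) :
    (eisensteinSystem K d).CorrespondsTo E (eisensteinSet K d) := by
  refine ⟨eisensteinSystem_tailCondition hd E, ?_⟩
  ext A
  rw [Set.mem_preimage, Set.mem_singleton_iff, eisensteinSystem_places (by omega : d ≠ 0),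
    Set.image_eq_empty, Set.eq_empty_iff_forall_notMem, Set.mem_compl_iff, eisensteinSet,
    Set.mem_ofPred_eq, not_exists]
  rfl

theorem isClopen_eisensteinSystem_fin (𝔭 : HeightOneSpectrum (𝓞 K)) :
    IsClopen ((eisensteinSystem K d).fin 𝔭) := by
  have hc : ∀ (i : Fin (d + 1)) (j : ℕ), IsClopen {a : Fin (d + 1) → 𝔭.adicCompletionIntegers K |
      a i ∈ localIdeal 𝔭 j} := fun i j => (isClopen_localIdeal 𝔭 j).preimage (continuous_apply i)
  have hm : IsClopen {a : Fin (d + 1) → 𝔭.adicCompletionIntegers K |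
      ∀ i, i ≠ 0 → i ≠ Fin.last d → a i ∈ localIdeal 𝔭 1} := by
    have : {a : Fin (d + 1) → 𝔭.adicCompletionIntegers K |
        ∀ i, i ≠ 0 → i ≠ Fin.last d → a i ∈ localIdeal 𝔭 1} =
        ⋂ i : {i : Fin (d + 1) // i ≠ 0 ∧ i ≠ Fin.last d}, {a | a i.1 ∈ localIdeal 𝔭 1} := by
      ext a; simp
    rw [this]
    exact isClopen_iInter_of_finite fun i => hc i.1 1
  exact ((hc 0 1).inter (hc 0 2).compl).inter (hm.inter (hc (Fin.last d) 1).compl)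

theorem eisensteinSystem_momentHypotheses (hd : 2 ≤ d) (E : Module.Basis ι ℤ (𝓞 K)) {n : ℕ}
    (hn : 1 ≤ n) : (eisensteinSystem K d).MomentHypotheses E n where
  boundary_fin 𝔭 := by rw [(isClopen_eisensteinSystem_fin 𝔭).frontier_eq, MeasureTheory.measure_empty]
  boundary_inf := by simp [eisensteinSystem]
  cone_inf := by simp [eisensteinSystem]
  tail := eisensteinSystem_tailCondition hd E
  bounds := by
    classical
    have hd0 : d ≠ 0 := by omega
    obtain ⟨c, hc⟩ := exists_ncard_large_eisenstein_lt (d := d) E hd0 hn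
    -- The exponent `α = 1 / n` with `c' = 1` is the truncation under which `n` distinct primes have
    -- product of residue characteristics at most `H`.
    refine ⟨1 / n, by positivity, 1, c, fun H hH A hA => ?_, majorant d, summable_majorant hd,
      fun H hH S hne hcard hS => ?_⟩
    · rw [eisensteinSystem_goodBox hd0] at hA
      simp only [Int.cast_one, one_mul, eisensteinSystem_mem_some hd0]
      exact_mod_cast hc H hH A hA
    · simp only [Int.cast_one, one_mul] at hS
      simp only [eisensteinSystem_goodBox hd0, eisensteinSystem_mem_some hd0]
      have h := card_box_eisenstein_le E hd0 S hne H (prod_primeBelow_le hn hH S hcard hS)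
      rw [← Set.ncard_coe_finset, Finset.coe_filter] at h
      exact h

theorem eisensteinSystem_hasMoment_one (hd : 2 ≤ d) (E : Module.Basis ι ℤ (𝓞 K)) :
    (eisensteinSystem K d).HasMoment E 1 (∑' 𝔭 : HeightOneSpectrum (𝓞 K), eisensteinWeight d 𝔭) := by
  have hd0 : d ≠ 0 := by omega
  simp only [LocalSystem.HasMoment, eisensteinSystem_goodBox hd0, ncard_eisensteinSystem_places hd0,
    pow_one]
  exact tendsto_boxAverage_count E hd

theorem eisensteinCount_eq_zero {A : Fin (d + 1) → 𝓞 K} (hA : A ∉ eisensteinSet K d) :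
    eisensteinCount A = 0 := by
  have : {𝔭 : HeightOneSpectrum (𝓞 K) | IsEisensteinAt 𝔭 A} = ∅ :=
    Set.eq_empty_of_forall_notMem fun 𝔭 h => hA ⟨𝔭, h⟩
  rw [eisensteinCount, this, Set.ncard_empty]

open scoped Classical in
theorem tendsto_card_box_filter_eisensteinSet (hd : 2 ≤ d) (E : Module.Basis ι ℤ (𝓞 K)) :
    Tendsto (fun H : ℕ => (((box E (d + 1) H).filter (· ∈ eisensteinSet K d)).card : ℝ) /
      boxSize K (d + 1) H) atTop
      (𝓝 (1 - ∏' 𝔭 : HeightOneSpectrum (𝓞 K), (1 - eisensteinWeight d 𝔭))) := by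
  refine (hasDensity_eisensteinSet E hd).congr fun H => ?_
  rw [← Set.ncard_coe_finset, Finset.coe_filter]
  rfl

-- Tuples outside `Γ^d` have count zero, so for a positive power the restriction changes only the
-- denominator of a moment.
open scoped Classical in
theorem sum_filter_eisensteinSet_count_pow (E : Module.Basis ι ℤ (𝓞 K)) {n : ℕ} (hn : n ≠ 0) (H : ℕ) :
    ∑ A ∈ box E (d + 1) H with A ∈ eisensteinSet K d, (eisensteinCount A : ℝ) ^ n =
      ∑ A ∈ box E (d + 1) H, (eisensteinCount A : ℝ) ^ n := by
  refine Finset.sum_filter_of_ne fun A _ h => ?_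
  by_contra hA
  exact h (by rw [eisensteinCount_eq_zero hA, Nat.cast_zero, zero_pow hn])

theorem eisensteinSystem_hasRestrictedMoment_one (hd : 2 ≤ d) (E : Module.Basis ι ℤ (𝓞 K))
    {ρ μ : ℝ} (hρ : ρ = 1 - ∏' 𝔭 : HeightOneSpectrum (𝓞 K), (1 - eisensteinWeight d 𝔭))
    (hμ : μ = ∑' 𝔭 : HeightOneSpectrum (𝓞 K), eisensteinWeight d 𝔭) (hρ0 : 0 < ρ) :
    (eisensteinSystem K d).HasRestrictedMoment E (eisensteinSet K d) 1 (ρ⁻¹ * μ) := by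
  classical
  have hd0 : d ≠ 0 := by omega
  simp only [LocalSystem.HasRestrictedMoment, eisensteinSystem_goodBox hd0,
    ncard_eisensteinSystem_places hd0]
  have h := (tendsto_boxAverage_count E hd).div (tendsto_card_box_filter_eisensteinSet hd E)
    (hρ ▸ hρ0.ne')
  rw [← hρ, ← hμ, div_eq_inv_mul μ ρ] at h
  refine h.congr' ?_
  filter_upwards [eventually_ge_atTop 1] with H hH
  rw [sum_filter_eisensteinSet_count_pow E one_ne_zero, Pi.div_apply, boxAverage,
    div_div_div_cancel_right₀ (boxSize_pos _ hH).ne']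
  simp only [pow_one]

theorem eisensteinSystem_hasRestrictedVariance (hd : 2 ≤ d) (E : Module.Basis ι ℤ (𝓞 K))
    {ρ μ : ℝ} (hρ : ρ = 1 - ∏' 𝔭 : HeightOneSpectrum (𝓞 K), (1 - eisensteinWeight d 𝔭))
    (hμ : μ = ∑' 𝔭 : HeightOneSpectrum (𝓞 K), eisensteinWeight d 𝔭) (hρ0 : 0 < ρ) :
    (eisensteinSystem K d).HasRestrictedVariance E (eisensteinSet K d)
      (1 / ρ * (μ ^ 2 - ∑' 𝔭 : HeightOneSpectrum (𝓞 K), eisensteinWeight d 𝔭 ^ 2 + μ)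
        - 2 * (ρ⁻¹ * μ) / ρ * μ + (ρ⁻¹ * μ) ^ 2) := by
  classical
  have hd0 : d ≠ 0 := by omega
  refine ⟨ρ⁻¹ * μ, eisensteinSystem_hasRestrictedMoment_one hd E hρ hμ hρ0, ?_⟩
  set e := ρ⁻¹ * μ
  simp only [eisensteinSystem_goodBox hd0, ncard_eisensteinSystem_places hd0]
  have hD := tendsto_card_box_filter_eisensteinSet hd E
  rw [← hρ] at hD
  have h1 := (tendsto_boxAverage_count E hd).div hD hρ0.ne'
  have h2 := (tendsto_boxAverage_count_sq E hd).div hD hρ0.ne'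
  rw [← hμ] at h1 h2
  have h := (h2.sub (h1.const_mul (2 * e))).add_const (e ^ 2)
  have he : (μ ^ 2 - ∑' 𝔭 : HeightOneSpectrum (𝓞 K), eisensteinWeight d 𝔭 ^ 2 + μ) / ρ -
      2 * e * (μ / ρ) + e ^ 2 =
      1 / ρ * (μ ^ 2 - ∑' 𝔭 : HeightOneSpectrum (𝓞 K), eisensteinWeight d 𝔭 ^ 2 + μ)
        - 2 * e / ρ * μ + e ^ 2 := by ring
  rw [he] at h
  refine h.congr' ?_
  -- As `ρ` is positive, the box eventually contains Eisenstein tuples; otherwise the constant term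
  -- `e ^ 2` would not survive division by their number.
  filter_upwards [eventually_ge_atTop 1, hD.eventually_ne hρ0.ne'] with H hH hne
  have hb := (boxSize_pos (K := K) (d + 1) hH).ne'
  have hc : (((box E (d + 1) H).filter (· ∈ eisensteinSet K d)).card : ℝ) ≠ 0 := fun h0 =>
    hne (by rw [h0, zero_div])
  have hexp : ∑ A ∈ box E (d + 1) H with A ∈ eisensteinSet K d, ((eisensteinCount A : ℝ) - e) ^ 2 =
      ∑ A ∈ box E (d + 1) H, (eisensteinCount A : ℝ) ^ 2 -
        2 * e * ∑ A ∈ box E (d + 1) H, (eisensteinCount A : ℝ) +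
        e ^ 2 * ((box E (d + 1) H).filter (· ∈ eisensteinSet K d)).card := by
    have hone := sum_filter_eisensteinSet_count_pow (d := d) E one_ne_zero H
    simp only [pow_one] at hone
    rw [← sum_filter_eisensteinSet_count_pow E two_ne_zero, ← hone, Finset.mul_sum,
      ← Finset.sum_sub_distrib, mul_comm (e ^ 2), ← nsmul_eq_mul, ← Finset.sum_const,
      ← Finset.sum_add_distrib]
    exact Finset.sum_congr rfl fun A _ => by ring
  rw [hexp, Pi.div_apply, Pi.div_apply, boxAverage, boxAverage, div_div_div_cancel_right₀ hb,
    div_div_div_cancel_right₀ hb]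
  field_simp

end System

end EisensteinMoments

open EisensteinMoments in
theorem corollary4p9 (K : Type*) [Field K] [NumberField K] (d : ℕ) (hd : 2 ≤ d) :
    -- the density of the Eisenstein polynomials, their mean, and the mean restricted to them
    let ρ : ℝ := 1 - ∏' 𝔭 : HeightOneSpectrum (𝓞 K), (1 - eisensteinWeight d 𝔭)
    let μ : ℝ := ∑' 𝔭 : HeightOneSpectrum (𝓞 K), eisensteinWeight d 𝔭
    let μΓ : ℝ := ρ⁻¹ * μ
    Multipliable (fun 𝔭 : HeightOneSpectrum (𝓞 K) => 1 - eisensteinWeight d 𝔭) ∧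
    Summable (fun 𝔭 : HeightOneSpectrum (𝓞 K) => eisensteinWeight d 𝔭) ∧
    Summable (fun 𝔭 : HeightOneSpectrum (𝓞 K) => eisensteinWeight d 𝔭 ^ 2) ∧
    0 < ρ ∧
    ∀ (ι : Type) [Fintype ι] (E : Module.Basis ι ℤ (𝓞 K)),
      (eisensteinSystem K d).CorrespondsTo E (eisensteinSet K d) ∧
      (∀ n : ℕ, 1 ≤ n → (eisensteinSystem K d).MomentHypotheses E n) ∧
      HasDensity E (eisensteinSet K d) ρ ∧
      (eisensteinSystem K d).HasMoment E 1 μ ∧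
      (eisensteinSystem K d).HasRestrictedMoment E (eisensteinSet K d) 1 μΓ ∧
      (eisensteinSystem K d).HasRestrictedVariance E (eisensteinSet K d)
        (1 / ρ * (μ ^ 2 - ∑' 𝔭 : HeightOneSpectrum (𝓞 K), eisensteinWeight d 𝔭 ^ 2 + μ)
          - 2 * μΓ / ρ * μ + μΓ ^ 2) := by
  intro ρ μ μΓ
  have hρ : 0 < ρ := sub_pos.2 (tprod_one_sub_eisensteinWeight_lt_one hd)
  exact ⟨multipliable_one_sub_eisensteinWeight hd, summable_eisensteinWeight hd,
    summable_eisensteinWeight_sq hd, hρ, fun ι _ E =>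
    ⟨eisensteinSystem_correspondsTo hd E, fun n hn => eisensteinSystem_momentHypotheses hd E hn,
      hasDensity_eisensteinSet E hd, eisensteinSystem_hasMoment_one hd E,
      eisensteinSystem_hasRestrictedMoment_one hd E rfl rfl hρ,
      eisensteinSystem_hasRestrictedVariance hd E rfl rfl hρ⟩⟩
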